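/- Let $d\ge 1$, $1<p<\infty$, $s\in(0,1]$, $\delta\in(0,1)$, and let $\mathcal D\subset\mathbb R^d$ be a bounded open set (in particular, any bounded domain; connectedness is not required). Put $\sigma(x)=\operatorname{dist}(x,\partial\mathcal D)$ and let $\mathfrak W^{s,p}[\delta](\mathcal D)$ be the space of all $u\in L^p(\mathcal D)$ (real-valued) such that $$[u]^p_{\mathfrak W^{s,p}[\delta](\mathcal D)}:=\overline C_{d,p}\int_{\mathcal D}\int_{B(x,\delta\sigma(x))}\frac{|u(x)-u(y)|^p}{\delta^{d+p}\,\sigma(x)^{d+sp}}\,dy\,dx<\infty,\qquad \overline C_{d,p}=\frac{d+p}{A_{d,p}},\quad A_{d,p}=\frac{2\pi^{(d-1)/2}\,\Gamma(\frac{p+1}{2})}{\Gamma(\frac{d+p}{2})},$$ with norm $\|u\|_{\mathfrak W^{s,p}[\delta](\mathcal D)}=\big(\|u\|_{L^p(\mathcal D)}^p+[u]^p_{\mathfrak W^{s,p}[\delta](\mathcal D)}\big)^{1/p}$. **Theorem (density of smooth functions).** For every $u\in\mathfrak W^{s,p}[\delta](\mathcal D)$ there is a sequence $(u_n)\subset C^\infty(\mathcal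 D)\cap\mathfrak W^{s,p}[\delta](\mathcal D)$ such that $\|u_n-u\|_{\mathfrak W^{s,p}[\delta](\mathcal D)}\to0$ as $n\to\infty$. If, in addition, $\mathcal D$ is Lipschitz (near each boundary point, in suitable Cartesian coordinates, $\mathcal D$ is the region strictly above the graph of a Lipschitz function), then the sequence can be chosen in $C^\infty(\overline{\mathcal D})\cap\mathfrak W^{s,p}[\delta](\mathcal D)$, where $C^\infty(\overline{\mathcal D})$ denotes the restrictions to $\mathcal D$ of functions in $C^\infty(\mathbb R^d)$. -/

import Mathlib

open scoped ContDiff Topology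

noncomputable section

namespace NonlocalSpace

/-- The distance to the boundary, `σ(x) = dist(x, ∂D)`. -/
def sigma {d : ℕ} (D : Set (EuclideanSpace ℝ (Fin d))) (x : EuclideanSpace ℝ (Fin d)) : ℝ :=
  Metric.infDist x (frontier D)

/-- `A_{d,p}`, the integral of `|ω · e|^p` over the unit sphere of `ℝ^d` for a unit vector `e`,
in closed form: `2 π^((d-1)/2) Γ((p+1)/2) / Γ((d+p)/2)`. -/
def sphereConst (d : ℕ) (p : ℝ) : ℝ :=
  2 * Real.pi ^ (((d : ℝ) - 1) / 2) * Real.Gamma ((p + 1) / 2) / Real.Gamma (((d : ℝ) + p) / 2)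

/-- The normalizing constant `(d + p) / A_{d,p}`. -/
def normConst (d : ℕ) (p : ℝ) : ℝ :=
  ((d : ℝ) + p) / sphereConst d p

/-- The `p`-th power of the seminorm,
`C ∫_D ∫_{B(x, δ σ(x))} |u(x) - u(y)|^p / (δ^(d+p) σ(x)^(d+sp)) dy dx`, as a number in `[0, ∞]`.
A function on `D` is represented by a function on the whole space; only its values on `D`
enter, because `B(x, δ σ(x)) ⊆ D` for `x ∈ D` and `δ ≤ 1`. -/
def seminormPow {d : ℕ} (D : Set (EuclideanSpace ℝ (Fin d))) (s p δ : ℝ)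
    (u : EuclideanSpace ℝ (Fin d) → ℝ) : ENNReal :=
  ENNReal.ofReal (normConst d p) *
    ∫⁻ x in D, ∫⁻ y in Metric.ball x (δ * sigma D x),
      ENNReal.ofReal
        (|u x - u y| ^ p / (δ ^ ((d : ℝ) + p) * sigma D x ^ ((d : ℝ) + s * p)))

/-- The norm `(‖u‖_{L^p(D)}^p + [u]^p)^(1/p)`, as a number in `[0, ∞]`. -/
def nonlocalNorm {d : ℕ} (D : Set (EuclideanSpace ℝ (Fin d))) (s p δ : ℝ)
    (u : EuclideanSpace ℝ (Fin d) → ℝ) : ENNReal :=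
  (MeasureTheory.eLpNorm u (ENNReal.ofReal p) (MeasureTheory.volume.restrict D) ^ p +
    seminormPow D s p δ u) ^ (1 / p)

/-- Membership in the nonlocal space: `u ∈ L^p(D)` with finite seminorm. -/
def MemNonlocal {d : ℕ} (D : Set (EuclideanSpace ℝ (Fin d))) (s p δ : ℝ)
    (u : EuclideanSpace ℝ (Fin d) → ℝ) : Prop :=
  MeasureTheory.MemLp u (ENNReal.ofReal p) (MeasureTheory.volume.restrict D) ∧
    seminormPow D s p δ u < ⊤

/-- `D` has a Lipschitz boundary: near each boundary point `z`, for some unit vector `e`, the set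
`D` is the part strictly above the graph of a Lipschitz function of the component
`x - ⟪e, x⟫ e` orthogonal to `e`. (Such a function on the hyperplane `e^⊥` is the same as the
restriction of a Lipschitz function on the whole space.) -/
def HasLipschitzBoundary {d : ℕ} (D : Set (EuclideanSpace ℝ (Fin d))) : Prop :=
  ∀ z ∈ frontier D, ∃ (e : EuclideanSpace ℝ (Fin d)) (r : ℝ) (K : NNReal)
    (g : EuclideanSpace ℝ (Fin d) → ℝ), ‖e‖ = 1 ∧ 0 < r ∧ LipschitzWith K g ∧
      ∀ x ∈ Metric.ball z r, x ∈ D ↔ g (x - inner ℝ e x • e) < inner ℝ e x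

/-- `v ∈ C^∞(D̄)`: on `D`, `v` is the restriction of a smooth function on the whole space. -/
def SmoothUpToBoundary {d : ℕ} (D : Set (EuclideanSpace ℝ (Fin d)))
    (v : EuclideanSpace ℝ (Fin d) → ℝ) : Prop :=
  ∃ V : EuclideanSpace ℝ (Fin d) → ℝ, ContDiff ℝ ∞ V ∧ Set.EqOn v V D

end NonlocalSpace

end

/-!
Write `τ(x)` for the distance from `x` to the complement of `D`, which on `D` is the distance to the
boundary. Up to a positive constant, the `p`-th power of the seminorm is
`energy u = ∫_D ∫_{|x - y| < δ τ(x)} |u(x) - u(y)|^p τ(x)^(-q) dy dx` with `q = d + s p`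
(`seminormPow_eq_energy`). Two facts about it drive the proof. Where `τ` is bounded below, the
kernel is bounded and the energy is controlled by the `L^p` norm
(`exists_energy_le_of_eq_zero`). And multiplication by a Lipschitz cutoff keeps the energy finite,
because `q ≤ d + p` (`energy_mul_lt_top`).

*Approximation in `C^∞(D)`.* On each shell `τ ~ 2^(-n)` the energy is dominated by a multiple of the
`L^p` norm. With a partition of unity `ζ_n` adapted to the shells and smooth functions `g_n`
sufficiently close to `u` in `L^p`, the function `∑ ζ_n g_n` is smooth on `D` and as close to `u` as
desired (`exists_contDiffOn_approx`). No regularity of the boundary is needed.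

*Approximation in `C^∞` up to a Lipschitz boundary.* A finite partition of unity on the closure
(`smoothlyApproximable_of_cone`) leaves functions `w` supported near a boundary point, where `D` is
locally stable under translations along an open cone of directions around a unit vector `e`
(`exists_coneCondition_of_lipschitz`). The approximants are `V_t(x) = ∫ ρ(v) w(x + t v) dv` with a
smooth density `ρ` concentrated near `e`; they are smooth on the whole space and converge to `w` in
`L^p`. For fixed `η`, the part of the energy of `V_t - w` coming from `τ ≥ η` tends to `0` with the
`L^p` norm. The part coming from `τ < η` is at most a constant times the energy of `w` in
`{τ < 3 η}`, uniformly in `t ≤ η` (`ConeCondition.exists_energy_shiftAverage_le`), and the latter is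
the tail of a convergent integral. This uniform bound is the heart of the matter, and has two cases.
* If `τ(x)` is at least a multiple of `t`, Jensen's inequality reduces it to a comparison of the
  kernel at `(x, y)` and at `(x + t v, y + t v)`; translation along the cone does not decrease `τ`,
  and here it increases `τ` at most by a constant factor (`energy_shiftAverage_le`).
* If `τ(x)` is smaller, `V_t` is Lipschitz near `x` with a constant given by the oscillation of `w`
  at scale `t` around `x + t e`. That point lies at distance comparable to `t` from the boundary, so
  that the oscillation is part of the energy of `w`, and the powers of `t` balance
  (`exists_energy_shiftAverage_le_near`).
-/

set_option linter.unusedSectionVars false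

open MeasureTheory Metric Set
open scoped ENNReal

noncomputable section

namespace NonlocalSpace

/-! ### The kernel and the energy -/

section Kernel

variable {E : Type*} [NormedAddCommGroup E]

/-- The weight `τ(x)^(-q)` on the set of pairs with `x ∈ D` and `|x - y| < δ τ(x)`, where
`τ(x) = dist(x, Dᶜ)`; it vanishes on all other pairs. On `D` the distance to the complement is the
distance to the boundary, and it has the advantage of being `0` off `D`. -/
def kernel (D : Set E) (δ q : ℝ) (x y : E) : ℝ≥0∞ :=
  {z : E × E | z.1 ∈ D ∧ dist z.2 z.1 < δ * infDist z.1 Dᶜ}.indicator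
    (fun z => ENNReal.ofReal (infDist z.1 Dᶜ ^ (-q))) (x, y)

variable {D : Set E} {δ q : ℝ} {x y : E}

theorem kernel_of_mem (hx : x ∈ D) (h : dist y x < δ * infDist x Dᶜ) :
    kernel D δ q x y = ENNReal.ofReal (infDist x Dᶜ ^ (-q)) :=
  indicator_of_mem (s := {z : E × E | z.1 ∈ D ∧ dist z.2 z.1 < δ * infDist z.1 Dᶜ})
    (a := (x, y)) ⟨hx, h⟩ _

theorem kernel_of_notMem (h : ¬ (x ∈ D ∧ dist y x < δ * infDist x Dᶜ)) :
    kernel D δ q x y = 0 :=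
  indicator_of_notMem (s := {z : E × E | z.1 ∈ D ∧ dist z.2 z.1 < δ * infDist z.1 Dᶜ})
    (a := (x, y)) h _

theorem kernel_ne_top : kernel D δ q x y ≠ ⊤ := by
  by_cases h : x ∈ D ∧ dist y x < δ * infDist x Dᶜ
  · rw [kernel_of_mem h.1 h.2]
    exact ENNReal.ofReal_ne_top
  · simp [kernel_of_notMem h]

theorem infDist_compl_pos (hD : IsOpen D) (hD' : Dᶜ.Nonempty) (hx : x ∈ D) :
    0 < infDist x Dᶜ :=
  (hD.isClosed_compl.notMem_iff_infDist_pos hD').1 (by simpa using hx)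

theorem infDist_le_add (s : Set E) (x y : E) : infDist x s ≤ infDist y s + dist x y :=
  infDist_le_infDist_add_dist

theorem mem_of_dist_lt_infDist_compl (hδ : δ ≤ 1) (h : dist y x < δ * infDist x Dᶜ) : y ∈ D :=
  ball_infDist_compl_subset (x := x) (mem_ball.2 (h.trans_le
    (mul_le_of_le_one_left infDist_nonneg hδ)))

theorem measurable_kernel [MeasurableSpace E] [BorelSpace E] [SecondCountableTopology E]
    (hD : IsOpen D) : Measurable fun z : E × E => kernel D δ q z.1 z.2 := by
  have h1 : Measurable fun z : E × E => infDist z.1 Dᶜ :=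
    ((continuous_infDist_pt _).comp continuous_fst).measurable
  refine Measurable.indicator (h1.pow_const _).ennreal_ofReal ?_
  exact (hD.measurableSet.preimage measurable_fst).inter
    (measurableSet_lt (continuous_snd.dist continuous_fst).measurable (h1.const_mul _))

end Kernel

variable {E : Type*} [NormedAddCommGroup E] [NormedSpace ℝ E] [FiniteDimensional ℝ E]
  [MeasureSpace E] [BorelSpace E]

/-- The part of the `p`-th power of the seminorm that comes from `x ∈ A`, up to the normalizing
constant. -/
def energy (D : Set E) (δ q p : ℝ) (A : Set E) (w : E → ℝ) : ℝ≥0∞ :=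
  ∫⁻ x in A, ∫⁻ y, kernel D δ q x y * ‖w x - w y‖ₑ ^ p

section Energy

variable {D A B C : Set E} {δ q p : ℝ} {u v w : E → ℝ}

theorem measurable_energy_integrand (hD : IsOpen D)
    (hw : Measurable w) :
    Measurable fun z : E × E => kernel D δ q z.1 z.2 * ‖w z.1 - w z.2‖ₑ ^ p :=
  (measurable_kernel hD).mul
    (((hw.comp measurable_fst).sub (hw.comp measurable_snd)).enorm.pow_const _)

variable [(volume : Measure E).IsAddHaarMeasure]

theorem measurable_energy_slice (hD : IsOpen D) (hw : Measurable w) (x : E) :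
    Measurable fun y : E => kernel D δ q x y * ‖w x - w y‖ₑ ^ p :=
  (measurable_energy_integrand hD hw).comp measurable_prodMk_left

theorem measurable_energy_inner (hD : IsOpen D) (hw : Measurable w) :
    Measurable fun x : E => ∫⁻ y, kernel D δ q x y * ‖w x - w y‖ₑ ^ p :=
  (measurable_energy_integrand hD hw).lintegral_prod_right'

/-- The energy only sees the almost everywhere class of a function on `D`. -/
theorem energy_congr_ae (hD : IsOpen D) (hδ : δ ≤ 1) (h : w =ᵐ[volume.restrict D] v) :
    energy D δ q p univ w = energy D δ q p univ v := by
  have h' := (ae_restrict_iff' hD.measurableSet).1 h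
  simp only [energy, Measure.restrict_univ]
  refine lintegral_congr_ae (h'.mono fun x hx => lintegral_congr_ae (h'.mono fun y hy => ?_))
  by_cases hk : x ∈ D ∧ dist y x < δ * infDist x Dᶜ
  · simp only [hx hk.1, hy (mem_of_dist_lt_infDist_compl hδ hk.2)]
  · simp [kernel_of_notMem hk]

theorem energy_mono_set (h : A ⊆ B) : energy D δ q p A w ≤ energy D δ q p B w :=
  lintegral_mono_set h

theorem energy_le_of_subset_union (h : A ⊆ B ∪ C) :
    energy D δ q p A w ≤ energy D δ q p B w + energy D δ q p C w :=
  (lintegral_mono_set h).trans (lintegral_union_le _ _ _)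

theorem enorm_add_rpow_le (hp : 1 ≤ p) (a b : ℝ) :
    ‖a + b‖ₑ ^ p ≤ 2 ^ (p - 1) * (‖a‖ₑ ^ p + ‖b‖ₑ ^ p) :=
  (ENNReal.rpow_le_rpow (enorm_add_le _ _) (by linarith)).trans
    (ENNReal.rpow_add_le_mul_rpow_add_rpow _ _ hp)

theorem energy_add_le (hD : IsOpen D) (hp : 1 ≤ p) (hv : Measurable v) :
    energy D δ q p A (fun x => v x + w x) ≤
      2 ^ (p - 1) * (energy D δ q p A v + energy D δ q p A w) := by
  have h2 : (2 : ℝ≥0∞) ^ (p - 1) ≠ ⊤ := ENNReal.rpow_ne_top_of_nonneg (by linarith) (by simp)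
  unfold energy
  rw [← lintegral_add_left (measurable_energy_inner hD hv), ← lintegral_const_mul' _ _ h2]
  refine lintegral_mono fun x => ?_
  rw [← lintegral_add_left (measurable_energy_slice hD hv x),
    ← lintegral_const_mul' _ _ h2]
  refine lintegral_mono fun y => ?_
  dsimp only [Function.comp]
  rw [← mul_add, mul_left_comm]
  gcongr
  rw [show v x + w x - (v y + w y) = (v x - v y) + (w x - w y) by ring]
  exact enorm_add_rpow_le hp _ _

theorem energy_eq_zero (hp : 0 < p) (hA : MeasurableSet A)
    (h : ∀ x ∈ A, x ∈ D → ∀ y, dist y x < δ * infDist x Dᶜ → w x = w y) :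
    energy D δ q p A w = 0 := by
  refine (setLIntegral_congr_fun hA fun x hx => ?_).trans (lintegral_zero (μ := volume.restrict _))
  refine (lintegral_congr fun y => ?_).trans lintegral_zero
  by_cases hk : x ∈ D ∧ dist y x < δ * infDist x Dᶜ
  · rw [h x hx hk.1 y hk.2, sub_self, enorm_zero, ENNReal.zero_rpow_of_pos hp, mul_zero]
  · rw [kernel_of_notMem hk, zero_mul]

theorem energy_neg : energy D δ q p A (fun x => -w x) = energy D δ q p A w := by
  unfold energy
  refine lintegral_congr fun x => lintegral_congr fun y => ?_
  rw [show -w x - -w y = -(w x - w y) by ring, enorm_neg]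

theorem rpow_enorm_add_lintegral_le {μ : Measure E} (hp : 1 ≤ p) (hv : Measurable v) :
    ∫⁻ x, ‖v x + w x‖ₑ ^ p ∂μ ≤
      2 ^ (p - 1) * (∫⁻ x, ‖v x‖ₑ ^ p ∂μ + ∫⁻ x, ‖w x‖ₑ ^ p ∂μ) := by
  have h2 : (2 : ℝ≥0∞) ^ (p - 1) ≠ ⊤ := ENNReal.rpow_ne_top_of_nonneg (by linarith) (by simp)
  rw [← lintegral_add_left (hv.enorm.pow_const _), ← lintegral_const_mul' _ _ h2]
  exact lintegral_mono fun x => enorm_add_rpow_le hp _ _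

/-- A convexity bound that replaces the triangle inequality for infinite sums: since
`∑ 2^(-(n+1)) = 1`, the number `∑ aₙ` is at most the supremum of `2^(n+1) aₙ`. -/
theorem tsum_rpow_le (hp : 0 < p) (a : ℕ → ℝ≥0∞) :
    (∑' n, a n) ^ p ≤ ∑' n, (2 ^ (n + 1) : ℝ≥0∞) ^ p * a n ^ p := by
  set S := ∑' n, (2 ^ (n + 1) : ℝ≥0∞) ^ p * a n ^ p with hS
  have h (n : ℕ) : 2 ^ (n + 1) * a n ≤ S ^ p⁻¹ := by
    rw [ENNReal.le_rpow_inv_iff hp, ENNReal.mul_rpow_of_nonneg _ _ hp.le]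
    exact ENNReal.le_tsum n
  rw [← ENNReal.le_rpow_inv_iff hp]
  calc ∑' n, a n = ∑' n, (2⁻¹ : ℝ≥0∞) ^ (n + 1) * (2 ^ (n + 1) * a n) := by
        refine tsum_congr fun n => ?_
        rw [← mul_assoc, ← mul_pow, ENNReal.inv_mul_cancel (by simp) (by simp), one_pow, one_mul]
    _ ≤ ∑' n, (2⁻¹ : ℝ≥0∞) ^ (n + 1) * S ^ p⁻¹ :=
        ENNReal.tsum_le_tsum fun n => by gcongr; exact h n
    _ = S ^ p⁻¹ := by
        rw [ENNReal.tsum_mul_right, ENNReal.tsum_geometric_add_one]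
        simp [ENNReal.one_sub_inv_two, ENNReal.inv_mul_cancel]

theorem enorm_tsum_rpow_le (hp : 0 < p) (a : ℕ → ℝ) :
    ‖∑' n, a n‖ₑ ^ p ≤ ∑' n, (2 ^ (n + 1) : ℝ≥0∞) ^ p * ‖a n‖ₑ ^ p :=
  (ENNReal.rpow_le_rpow enorm_tsum_le_tsum_enorm hp.le).trans (tsum_rpow_le hp _)

theorem lintegral_tsum_rpow_le {μ : Measure E} (hp : 0 < p) {f : ℕ → E → ℝ}
    (hf : ∀ n, Measurable (f n)) :
    ∫⁻ x, ‖∑' n, f n x‖ₑ ^ p ∂μ ≤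
      ∑' n, (2 ^ (n + 1) : ℝ≥0∞) ^ p * ∫⁻ x, ‖f n x‖ₑ ^ p ∂μ := by
  calc _ ≤ ∫⁻ x, ∑' n, (2 ^ (n + 1) : ℝ≥0∞) ^ p * ‖f n x‖ₑ ^ p ∂μ :=
        lintegral_mono fun x => enorm_tsum_rpow_le hp _
    _ = _ := by
        rw [lintegral_tsum fun n => (((hf n).enorm.pow_const _).const_mul _).aemeasurable]
        exact tsum_congr fun n => lintegral_const_mul _ ((hf n).enorm.pow_const _)

theorem energy_tsum_le (hD : IsOpen D) (hp : 0 < p) {f : ℕ → E → ℝ}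
    (hf : ∀ n, Measurable (f n)) (hs : ∀ x, Summable fun n => f n x) :
    energy D δ q p A (fun x => ∑' n, f n x) ≤
      ∑' n, (2 ^ (n + 1) : ℝ≥0∞) ^ p * energy D δ q p A (f n) := by
  calc _ ≤ ∫⁻ x in A, ∫⁻ y, ∑' n, (2 ^ (n + 1) : ℝ≥0∞) ^ p *
          (kernel D δ q x y * ‖f n x - f n y‖ₑ ^ p) := by
        refine lintegral_mono fun x => lintegral_mono fun y => ?_
        dsimp only
        simp_rw [mul_left_comm, ENNReal.tsum_mul_left]
        rw [← (hs x).tsum_sub (hs y)]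
        gcongr
        exact enorm_tsum_rpow_le hp _
    _ = ∫⁻ x in A, ∑' n, (2 ^ (n + 1) : ℝ≥0∞) ^ p *
          ∫⁻ y, kernel D δ q x y * ‖f n x - f n y‖ₑ ^ p := by
        refine lintegral_congr fun x => ?_
        have h (n : ℕ) : Measurable fun y => kernel D δ q x y * ‖f n x - f n y‖ₑ ^ p :=
          measurable_energy_slice hD (hf n) x
        rw [lintegral_tsum fun n => ((h n).const_mul _).aemeasurable]
        exact tsum_congr fun n => lintegral_const_mul _ (h n)
    _ = _ := by
        rw [lintegral_tsum fun n => ((measurable_energy_inner hD (hf n)).const_mul _).aemeasurable]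
        exact tsum_congr fun n => lintegral_const_mul _ (measurable_energy_inner hD (hf n))

/-! ### Energy bounds -/

/-- Away from the boundary the kernel is bounded, so that the energy is controlled by the
`L^p` norm. -/
theorem exists_energy_le_lintegral (hp : 1 ≤ p) (hδ : δ ≤ 1) (hq : 0 ≤ q)
    {R : ℝ} (hR : ∀ x ∈ D, infDist x Dᶜ ≤ R) {m : ℝ} (hm : 0 < m) :
    ∃ c : ℝ≥0∞, c ≠ ⊤ ∧ ∀ A : Set E, MeasurableSet A → (∀ x ∈ A, x ∈ D → m ≤ infDist x Dᶜ) →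
      ∀ w : E → ℝ, Measurable w → energy D δ q p A w ≤ c * ∫⁻ x, ‖w x‖ₑ ^ p := by
  have h2 : (2 : ℝ≥0∞) ^ (p - 1) ≠ ⊤ := ENNReal.rpow_ne_top_of_nonneg (by linarith) (by simp)
  set M := ENNReal.ofReal (m ^ (-q)) with hM
  set V := volume (ball (0 : E) R) with hV
  refine ⟨2 ^ (p - 1) * (M * (V + V)), ?_, fun A hA hAm w hw => ?_⟩
  · have : V ≠ ⊤ := measure_ball_lt_top.ne
    finiteness
  have hk : ∀ x ∈ A, ∀ y, kernel D δ q x y ≤ (ball x R).indicator (fun _ => M) y := by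
    intro x hx y
    by_cases h : x ∈ D ∧ dist y x < δ * infDist x Dᶜ
    · have hy : y ∈ ball x R := mem_ball.2 <| h.2.trans_le <|
        (mul_le_of_le_one_left infDist_nonneg hδ).trans (hR x h.1)
      rw [kernel_of_mem h.1 h.2, indicator_of_mem hy]
      exact ENNReal.ofReal_le_ofReal
        (Real.rpow_le_rpow_of_nonpos hm (hAm x hx h.1) (by linarith))
    · simp [kernel_of_notMem h]
  have hwp : Measurable fun x => ‖w x‖ₑ ^ p := hw.enorm.pow_const _
  have hball : MeasurableSet {z : E × E | z.2 ∈ ball z.1 R} :=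
    measurableSet_lt (continuous_snd.dist continuous_fst).measurable measurable_const
  have hind : Measurable fun z : E × E => (ball z.1 R).indicator (fun _ => M) z.2 :=
    (measurable_const (a := M)).indicator hball
  have hi1 (x : E) : ∫⁻ y, (ball x R).indicator (fun _ => M) y = M * V := by
    rw [lintegral_indicator_const measurableSet_ball, Measure.addHaar_ball_center]
  have hi2 (y : E) : ∫⁻ x, (ball x R).indicator (fun _ => M) y = M * V := by
    rw [← hi1 y]
    refine lintegral_congr fun x => ?_
    simp only [indicator, mem_ball, dist_comm]
  calc energy D δ q p A w
      ≤ ∫⁻ x in A, ∫⁻ y, (2 ^ (p - 1) * ((ball x R).indicator (fun _ => M) y * ‖w x‖ₑ ^ p +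
          (ball x R).indicator (fun _ => M) y * ‖w y‖ₑ ^ p)) := by
        refine setLIntegral_mono' hA fun x hx => lintegral_mono fun y => ?_
        dsimp only
        rw [← mul_add, mul_left_comm]
        refine mul_le_mul' (hk x hx y) ?_
        have := enorm_add_rpow_le hp (w x) (-w y)
        rwa [enorm_neg, ← sub_eq_add_neg] at this
    _ ≤ ∫⁻ x, ∫⁻ y, (2 ^ (p - 1) * ((ball x R).indicator (fun _ => M) y * ‖w x‖ₑ ^ p +
          (ball x R).indicator (fun _ => M) y * ‖w y‖ₑ ^ p)) := setLIntegral_le_lintegral _ _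
    _ = 2 ^ (p - 1) * ((∫⁻ x, ∫⁻ y, (ball x R).indicator (fun _ => M) y * ‖w x‖ₑ ^ p) +
          ∫⁻ x, ∫⁻ y, (ball x R).indicator (fun _ => M) y * ‖w y‖ₑ ^ p) := by
        have hm1 : Measurable fun z : E × E =>
            (ball z.1 R).indicator (fun _ => M) z.2 * ‖w z.1‖ₑ ^ p :=
          hind.mul (hwp.comp measurable_fst)
        rw [← lintegral_add_left hm1.lintegral_prod_right', ← lintegral_const_mul' _ _ h2]
        refine lintegral_congr fun x => ?_
        dsimp only
        rw [lintegral_const_mul' _ _ h2,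
          lintegral_add_left ((measurable_const.indicator measurableSet_ball).mul_const _)]
    _ = 2 ^ (p - 1) * (M * (V + V)) * ∫⁻ x, ‖w x‖ₑ ^ p := by
        have e1 : ∫⁻ x, ∫⁻ y, (ball x R).indicator (fun _ => M) y * ‖w x‖ₑ ^ p =
            M * V * ∫⁻ x, ‖w x‖ₑ ^ p := by
          rw [← lintegral_const_mul _ hwp]
          refine lintegral_congr fun x => ?_
          rw [lintegral_mul_const _ (measurable_const.indicator measurableSet_ball), hi1]
        have e2 : ∫⁻ x, ∫⁻ y, (ball x R).indicator (fun _ => M) y * ‖w y‖ₑ ^ p =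
            M * V * ∫⁻ x, ‖w x‖ₑ ^ p := by
          rw [lintegral_lintegral_swap (hind.mul (hwp.comp measurable_snd)).aemeasurable,
            ← lintegral_const_mul _ hwp]
          refine lintegral_congr fun y => ?_
          have hy : Measurable fun x => (ball x R).indicator (fun _ => M) y :=
            hind.comp measurable_prodMk_right
          rw [lintegral_mul_const _ hy, hi2]
        rw [e1, e2]
        ring

/-- If `w` vanishes where `τ ≤ m`, then so does the inner integral where `τ < m / 2`, because a ball
of radius `δ τ(x) ≤ τ(x)` about `x` stays in `{τ ≤ 2 τ(x)}`. -/
theorem exists_energy_le_of_eq_zero (hp : 1 ≤ p) (hδ : δ ≤ 1) (hq : 0 ≤ q)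
    {R : ℝ} (hR : ∀ x ∈ D, infDist x Dᶜ ≤ R) {m : ℝ} (hm : 0 < m) :
    ∃ c : ℝ≥0∞, c ≠ ⊤ ∧ ∀ w : E → ℝ, Measurable w → (∀ x ∈ D, infDist x Dᶜ ≤ m → w x = 0) →
      energy D δ q p univ w ≤ c * ∫⁻ x, ‖w x‖ₑ ^ p := by
  obtain ⟨c, hc, h⟩ := exists_energy_le_lintegral hp hδ hq hR (half_pos hm)
  refine ⟨c, hc, fun w hw hw0 => ?_⟩
  have hA : MeasurableSet {x : E | infDist x Dᶜ < m / 2} :=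
    measurableSet_lt (continuous_infDist_pt _).measurable measurable_const
  refine le_trans ?_ (h {x : E | infDist x Dᶜ < m / 2}ᶜ hA.compl
    (fun x hx _ => by simpa using hx) w hw)
  refine (energy_le_of_subset_union (B := {x : E | infDist x Dᶜ < m / 2})
    (by rw [union_compl_self])).trans_eq ?_
  rw [energy_eq_zero (by linarith) hA fun x hx hxD y hy => ?_, zero_add]
  have hx' : infDist x Dᶜ < m / 2 := hx
  have h1 : dist y x < infDist x Dᶜ := hy.trans_le (mul_le_of_le_one_left infDist_nonneg hδ)
  have h2 := infDist_le_add Dᶜ y x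
  rw [hw0 x hxD (by linarith), hw0 y (mem_of_dist_lt_infDist_compl hδ hy) (by linarith)]

theorem volume_ball_eq (x : E) {r : ℝ} (hr : 0 < r) :
    volume (ball x r) = ENNReal.ofReal (r ^ Module.finrank ℝ E) * volume (ball (0 : E) 1) :=
  Measure.addHaar_ball_of_pos _ _ hr

/-- Multiplication by a Lipschitz cutoff function preserves finiteness of the energy. The
assumption on the exponents is `s ≤ 1`. -/
theorem energy_mul_lt_top (hD : IsOpen D) (hD' : Dᶜ.Nonempty) (hp : 1 ≤ p) (hδ : δ ≤ 1)
    (hq : q ≤ Module.finrank ℝ E + p)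
    {R : ℝ} (hR : ∀ x ∈ D, infDist x Dᶜ ≤ R) {ζ : E → ℝ} {L : NNReal} (hζL : LipschitzWith L ζ)
    (hζ1 : ∀ x, ‖ζ x‖ₑ ≤ 1) (hu : Measurable u) (hu1 : energy D δ q p univ u < ⊤)
    (hu2 : ∫⁻ x, ‖u x‖ₑ ^ p < ⊤) :
    energy D δ q p univ (fun x => ζ x * u x) < ⊤ := by
  have hp0 : 0 ≤ p := by linarith
  have h2 : (2 : ℝ≥0∞) ^ (p - 1) ≠ ⊤ := ENNReal.rpow_ne_top_of_nonneg (by linarith) (by simp)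
  set n := Module.finrank ℝ E with hn
  set V := volume (ball (0 : E) 1) with hV
  have hVt : V ≠ ⊤ := measure_ball_lt_top.ne
  set K : ℝ≥0∞ := ENNReal.ofReal (R ^ (n + p - q)) * V with hK
  have hpt (x y : E) : kernel D δ q x y * ‖ζ x * u x - ζ y * u y‖ₑ ^ p ≤
      2 ^ (p - 1) * (kernel D δ q x y * ‖u x - u y‖ₑ ^ p +
        kernel D δ q x y * (L * ENNReal.ofReal (infDist x Dᶜ)) ^ p * ‖u x‖ₑ ^ p) := by
    by_cases hk : x ∈ D ∧ dist y x < δ * infDist x Dᶜ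
    · rw [mul_assoc (kernel D δ q x y), ← mul_add, mul_left_comm]
      gcongr
      rw [show ζ x * u x - ζ y * u y = ζ y * (u x - u y) + (ζ x - ζ y) * u x by ring]
      refine (enorm_add_rpow_le hp _ _).trans ?_
      rw [enorm_mul, enorm_mul, ← ENNReal.mul_rpow_of_nonneg _ _ hp0]
      gcongr
      · exact mul_le_of_le_one_left' (hζ1 y)
      · rw [← edist_eq_enorm_sub]
        refine (hζL x y).trans ?_
        gcongr
        rw [edist_dist]
        refine ENNReal.ofReal_le_ofReal ?_
        rw [dist_comm]
        exact hk.2.le.trans (mul_le_of_le_one_left infDist_nonneg hδ)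
    · simp [kernel_of_notMem hk]
  have hin (x : E) : ∫⁻ y, kernel D δ q x y * (L * ENNReal.ofReal (infDist x Dᶜ)) ^ p * ‖u x‖ₑ ^ p ≤
      (L : ℝ≥0∞) ^ p * K * ‖u x‖ₑ ^ p := by
    have hkx : Measurable fun y => kernel D δ q x y :=
      (measurable_kernel hD).comp measurable_prodMk_left
    rw [lintegral_mul_const _ (hkx.mul_const _), lintegral_mul_const _ hkx]
    refine mul_le_mul' ?_ le_rfl
    by_cases hx : x ∈ D
    · have ht := infDist_compl_pos hD hD' hx
      set t := infDist x Dᶜ with htdef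
      have hker : ∫⁻ y, kernel D δ q x y ≤
          ENNReal.ofReal (t ^ (-q)) * (ENNReal.ofReal (t ^ n) * V) := by
        calc ∫⁻ y, kernel D δ q x y ≤ ∫⁻ y, (ball x t).indicator
              (fun _ => ENNReal.ofReal (t ^ (-q))) y := by
              refine lintegral_mono fun y => ?_
              by_cases h : dist y x < δ * infDist x Dᶜ
              · rw [kernel_of_mem hx h, indicator_of_mem]
                exact mem_ball.2 (h.trans_le (mul_le_of_le_one_left infDist_nonneg hδ))
              · simp [kernel_of_notMem (fun h' => h h'.2)]
          _ = _ := by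
              rw [lintegral_indicator_const measurableSet_ball, volume_ball_eq x ht]
      calc _ ≤ ENNReal.ofReal (t ^ (-q)) * (ENNReal.ofReal (t ^ n) * V) *
            (L * ENNReal.ofReal t) ^ p := by gcongr
        _ = (L : ℝ≥0∞) ^ p * (ENNReal.ofReal (t ^ (-q) * t ^ n * t ^ p) * V) := by
            rw [ENNReal.mul_rpow_of_nonneg _ _ hp0, ENNReal.ofReal_rpow_of_pos ht,
              ENNReal.ofReal_mul (by positivity), ENNReal.ofReal_mul (by positivity)]
            ring
        _ ≤ (L : ℝ≥0∞) ^ p * K := by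
            rw [hK]
            gcongr
            rw [← Real.rpow_natCast, ← Real.rpow_add ht, ← Real.rpow_add ht,
              show -q + n + p = n + p - q by ring]
            exact Real.rpow_le_rpow ht.le (hR x hx) (by linarith)
    · have (y : E) : kernel D δ q x y = 0 := kernel_of_notMem fun h => hx h.1
      simp [this]
  calc energy D δ q p univ (fun x => ζ x * u x)
      ≤ ∫⁻ x, ∫⁻ y, 2 ^ (p - 1) * (kernel D δ q x y * ‖u x - u y‖ₑ ^ p +
        kernel D δ q x y * (L * ENNReal.ofReal (infDist x Dᶜ)) ^ p * ‖u x‖ₑ ^ p) := by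
        rw [energy, Measure.restrict_univ]
        exact lintegral_mono fun x => lintegral_mono fun y => hpt x y
    _ ≤ ∫⁻ x, 2 ^ (p - 1) * ((∫⁻ y, kernel D δ q x y * ‖u x - u y‖ₑ ^ p) +
        (L : ℝ≥0∞) ^ p * K * ‖u x‖ₑ ^ p) := by
        refine lintegral_mono fun x => ?_
        dsimp only
        rw [lintegral_const_mul' _ _ h2, lintegral_add_left (measurable_energy_slice hD hu x)]
        gcongr
        exact hin x
    _ = 2 ^ (p - 1) * (energy D δ q p univ u + (L : ℝ≥0∞) ^ p * K * ∫⁻ x, ‖u x‖ₑ ^ p) := by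
        rw [lintegral_const_mul' _ _ h2, lintegral_add_left (measurable_energy_inner hD hu),
          lintegral_const_mul _ (hu.enorm.pow_const _), energy, Measure.restrict_univ]
    _ < ⊤ := by
        have : (L : ℝ≥0∞) ^ p ≠ ⊤ := ENNReal.rpow_ne_top_of_nonneg hp0 (by simp)
        have hKt : K ≠ ⊤ := ENNReal.mul_ne_top (by simp) hVt
        have h3 := hu1.ne
        have h4 := hu2.ne
        finiteness

end Energy

/-! ### Smooth approximation inside an open set -/

section Interior

variable [(volume : Measure E).IsAddHaarMeasure] {D : Set E} {δ q p : ℝ} {u : E → ℝ}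

theorem memLp_of_lintegral_lt_top (hp : 1 ≤ p) (hu : Measurable u) {μ : Measure E}
    (hu2 : ∫⁻ x, ‖u x‖ₑ ^ p ∂μ < ⊤) : MemLp u (ENNReal.ofReal p) μ := by
  have hp0 : 0 < p := by linarith
  refine ⟨hu.aestronglyMeasurable, ?_⟩
  rwa [eLpNorm_lt_top_iff_lintegral_rpow_enorm_lt_top (by simpa using hp0) (by simp),
    ENNReal.toReal_ofReal hp0.le]

theorem eLpNorm_rpow_eq (hp : 1 ≤ p) {μ : Measure E} :
    eLpNorm u (ENNReal.ofReal p) μ ^ p = ∫⁻ x, ‖u x‖ₑ ^ p ∂μ := by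
  have hp0 : 0 < p := by linarith
  rw [eLpNorm_eq_lintegral_rpow_enorm_toReal (by simpa using hp0) (by simp),
    ENNReal.toReal_ofReal hp0.le, ← ENNReal.rpow_mul, one_div, inv_mul_cancel₀ hp0.ne',
    ENNReal.rpow_one]

theorem exists_contDiff_lintegral_le (hp : 1 ≤ p) (hu : Measurable u)
    (hu2 : ∫⁻ x, ‖u x‖ₑ ^ p < ⊤) {ε : ℝ≥0∞} (hε : ε ≠ 0) :
    ∃ g : E → ℝ, ContDiff ℝ ∞ g ∧ ∫⁻ x, ‖g x - u x‖ₑ ^ p ≤ ε := by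
  have hp0 : 0 < p := by linarith
  have h1 : 0 < (min ε 1).toReal :=
    ENNReal.toReal_pos (by simp [hε]) (ne_top_of_le_ne_top ENNReal.one_ne_top (min_le_right _ _))
  obtain ⟨g, -, hg, hgu⟩ := (memLp_of_lintegral_lt_top hp hu hu2).exist_eLpNorm_sub_le (by simp)
    (by simpa using hp) (Real.rpow_pos_of_pos h1 p⁻¹)
  refine ⟨g, hg, ?_⟩
  have h2 := ENNReal.rpow_le_rpow hgu hp0.le
  rw [eLpNorm_sub_comm, eLpNorm_rpow_eq hp, ENNReal.ofReal_rpow_of_pos (Real.rpow_pos_of_pos h1 _),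
    ← Real.rpow_mul h1.le, inv_mul_cancel₀ hp0.ne', Real.rpow_one] at h2
  exact h2.trans (ENNReal.ofReal_toReal_le.trans (min_le_left _ _))

theorem exists_contDiff_zero_one {a b : ℝ} (hab : a < b) (S : Set E) :
    ∃ χ : E → ℝ, ContDiff ℝ ∞ χ ∧ (∀ x, infDist x S ≤ a → χ x = 0) ∧
      (∀ x, b ≤ infDist x S → χ x = 1) ∧ ∀ x, χ x ∈ Icc (0 : ℝ) 1 := by
  have hc : Continuous fun x : E => infDist x S := continuous_infDist_pt _
  obtain ⟨f, hf0, hf1, hf⟩ := exists_contMDiffMap_zero_one_of_isClosed (n := ⊤)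
    (modelWithCornersSelf ℝ E) (isClosed_le hc (continuous_const (y := a)))
    (isClosed_le (continuous_const (y := b)) hc)
    (Set.disjoint_left.2 fun x hx hx' => (lt_irrefl _ ((le_trans hx' hx).trans_lt hab)))
  exact ⟨f, f.contMDiff.contDiff, fun x hx => hf0 hx, fun x hx => hf1 hx, hf⟩

/-- A smooth partition of unity on `D` by functions living in the shells
`R / 2^(n+1) < dist(x, Dᶜ) ≤ R / 2^(n-1)`, obtained by telescoping cutoff functions. -/
theorem exists_shell_partition {R : ℝ} (hR0 : 0 < R) (hR : ∀ x, infDist x Dᶜ ≤ R) :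
    ∃ ζ : ℕ → E → ℝ, (∀ n, ContDiff ℝ ∞ (ζ n)) ∧ (∀ n x, ‖ζ n x‖ₑ ≤ 1) ∧
      (∀ n x, infDist x Dᶜ ≤ R / 2 ^ (n + 1) → ζ n x = 0) ∧
      (∀ N x, R / 2 ^ N < infDist x Dᶜ → ∀ n, N < n → ζ n x = 0) ∧
      (∀ N x, R / 2 ^ N < infDist x Dᶜ → ∑ n ∈ Finset.range (N + 1), ζ n x = 1) := by
  have hlt (n : ℕ) : R / 2 ^ n < 2 * R / 2 ^ n := by
    have : 0 < R / 2 ^ n := by positivity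
    rw [mul_div_assoc]; linarith
  choose χ hχ h0 h1 h01 using fun n : ℕ => exists_contDiff_zero_one (hlt n) Dᶜ
  have hmono (n m : ℕ) (h : n ≤ m) : R / 2 ^ m ≤ R / 2 ^ n := by gcongr; norm_num
  have hsucc (n : ℕ) : 2 * R / 2 ^ (n + 1) = R / 2 ^ n := by rw [pow_succ]; field_simp
  -- `R` bounds the distance to the complement, so that the first cutoff is trivial
  have hz (x : E) : χ 0 x = 0 := h0 0 x (by simpa using hR x)
  refine ⟨fun n x => χ (n + 1) x - χ n x, fun n => (hχ _).sub (hχ _), fun n x => ?_,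
    fun n x hx => ?_, fun N x hx n hn => ?_, fun N x hx => ?_⟩
  · rw [Real.enorm_eq_ofReal_abs, ENNReal.ofReal_le_one, abs_le]
    have := h01 (n + 1) x
    have := h01 n x
    simp only [mem_Icc] at *
    constructor <;> linarith
  · dsimp only
    rw [h0 _ x hx, h0 n x (hx.trans (hmono _ _ (Nat.le_succ n))), sub_zero]
  · dsimp only
    obtain ⟨k, rfl⟩ : ∃ k, n = k + 1 := ⟨n - 1, by omega⟩
    rw [h1 _ x, h1 _ x, sub_self]
    · rw [hsucc]; exact (hmono N k (by omega)).trans hx.le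
    · rw [hsucc]; exact (hmono N (k + 1) (by omega)).trans hx.le
  · rw [Finset.sum_range_sub (fun n => χ n x), hz, sub_zero]
    exact h1 _ x (by rw [hsucc]; exact hx.le)

/-- Smooth functions on `D` approximate every `u ∈ L^p` in the energy, even when the energy of `u`
itself is infinite: in each shell the energy is controlled by the `L^p` norm, with a constant that
depends on the shell and is beaten by the accuracy of the approximation there. -/
theorem exists_contDiffOn_approx (hD : IsOpen D) (hD' : Dᶜ.Nonempty) (hp : 1 ≤ p) (hδ : δ ≤ 1)
    (hq : 0 ≤ q) {R : ℝ} (hR0 : 0 < R) (hR : ∀ x, infDist x Dᶜ ≤ R) (hu : Measurable u)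
    (hu2 : ∫⁻ x, ‖u x‖ₑ ^ p < ⊤) {ε : ℝ≥0∞} (hε : ε ≠ 0) :
    ∃ v : E → ℝ, ContDiffOn ℝ ∞ v D ∧ ∫⁻ x, ‖v x - u x‖ₑ ^ p ≤ ε ∧
      energy D δ q p univ (fun x => v x - u x) ≤ ε := by
  have hp0 : 0 < p := by linarith
  obtain ⟨ζ, hζ, hζ1, hζ0, hζN, hζs⟩ := exists_shell_partition (D := D) hR0 hR
  have hpos (n : ℕ) : 0 < R / 2 ^ (n + 1) := by positivity
  choose c hc hcE using fun n : ℕ =>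
    exists_energy_le_of_eq_zero (q := q) hp hδ hq (fun x _ => hR x) (hpos n)
  obtain ⟨e, he0, he⟩ := ENNReal.exists_pos_sum_of_countable' hε ℕ
  set K : ℕ → ℝ≥0∞ := fun n => (2 ^ (n + 1) : ℝ≥0∞) ^ p * (c n + 1) with hK
  have h2t (n : ℕ) : (2 ^ (n + 1) : ℝ≥0∞) ^ p ≠ ⊤ :=
    ENNReal.rpow_ne_top_of_nonneg hp0.le (by simp)
  have hKt (n : ℕ) : K n ≠ ⊤ := ENNReal.mul_ne_top (h2t n) (by simp [hc n])
  have hK0 (n : ℕ) : K n ≠ 0 := by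
    refine mul_ne_zero ?_ (by simp)
    exact (ENNReal.rpow_pos (by positivity) (by simp)).ne'
  choose g hg hgu using fun n : ℕ => exists_contDiff_lintegral_le hp hu hu2
    (ENNReal.div_pos (he0 n).ne' (hKt n)).ne'
  set f : ℕ → E → ℝ := fun n x => ζ n x * (g n x - u x) with hf
  have hfm (n : ℕ) : Measurable (f n) :=
    (hζ n).continuous.measurable.mul ((hg n).continuous.measurable.sub hu)
  have hloc : ∀ x ∈ D, ∃ N : ℕ, R / 2 ^ N < infDist x Dᶜ := fun x hx => by
    obtain ⟨N, hN⟩ := exists_pow_lt_of_lt_one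
      (div_pos (infDist_compl_pos hD hD' hx) hR0) (one_half_lt_one (α := ℝ))
    refine ⟨N, ?_⟩
    rw [lt_div_iff₀ hR0] at hN
    rwa [div_eq_inv_mul, ← inv_pow, ← one_div]
  have hfs : ∀ x, Summable fun n => f n x := fun x => by
    by_cases hx : x ∈ D
    · obtain ⟨N, hN⟩ := hloc x hx
      refine summable_of_ne_finset_zero (s := Finset.range (N + 1)) fun n hn => ?_
      simp only [hf, hζN N x hN n (by simpa [Nat.lt_succ_iff] using hn), zero_mul]
    · have : (fun n => f n x) = fun _ => 0 := by
        funext n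
        have : infDist x Dᶜ = 0 := infDist_zero_of_mem (by simpa using hx)
        simp only [hf, hζ0 n x (this.le.trans (hpos n).le), zero_mul]
      rw [this]; exact summable_zero
  have hfp (n : ℕ) : ∫⁻ x, ‖f n x‖ₑ ^ p ≤ e n / K n := by
    refine (lintegral_mono fun x => ?_).trans (hgu n)
    refine ENNReal.rpow_le_rpow ?_ hp0.le
    rw [hf, enorm_mul]
    exact mul_le_of_le_one_left' (hζ1 n x)
  have hfE (n : ℕ) : energy D δ q p univ (f n) ≤ c n * (e n / K n) := by
    refine (hcE n (f n) (hfm n) fun x _ hx => ?_).trans (by gcongr; exact hfp n)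
    simp only [hf, hζ0 n x hx, zero_mul]
  have hsub : (fun x => (u x + ∑' n, f n x) - u x) = fun x => ∑' n, f n x := by
    funext x; ring
  refine ⟨fun x => u x + ∑' n, f n x, fun x hx => ContDiffAt.contDiffWithinAt ?_, ?_, ?_⟩
  · obtain ⟨N, hN⟩ := hloc x hx
    have hev : ∀ᶠ y in 𝓝 x, R / 2 ^ N < infDist y Dᶜ :=
      (continuous_infDist_pt _).continuousAt.eventually_const_lt hN
    have hsm : ContDiff ℝ ∞ fun y => ∑ n ∈ Finset.range (N + 1), ζ n y * g n y :=
      ContDiff.sum fun n _ => (hζ n).mul (hg n)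
    refine hsm.contDiffAt.congr_of_eventuallyEq (hev.mono fun y hy => ?_)
    dsimp only
    rw [tsum_eq_sum (s := Finset.range (N + 1)) fun n hn => by
      simp only [hf, hζN N y hy n (by simpa [Nat.lt_succ_iff] using hn), zero_mul]]
    simp only [hf, mul_sub, Finset.sum_sub_distrib, ← Finset.sum_mul, hζs N y hy]
    ring
  · simp only [add_sub_cancel_left]
    refine ((lintegral_tsum_rpow_le hp0 hfm).trans (ENNReal.tsum_le_tsum fun n => ?_)).trans he.le
    calc _ ≤ (2 ^ (n + 1) : ℝ≥0∞) ^ p * (c n + 1) * (e n / K n) := by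
          gcongr
          · exact le_mul_of_one_le_right' le_add_self
          · exact hfp n
      _ = e n := ENNReal.mul_div_cancel (hK0 n) (hKt n)
  · rw [hsub]
    refine ((energy_tsum_le hD hp0 hfm hfs).trans (ENNReal.tsum_le_tsum fun n => ?_)).trans he.le
    calc _ ≤ (2 ^ (n + 1) : ℝ≥0∞) ^ p * (c n * (e n / K n)) := by gcongr; exact hfE n
      _ ≤ (2 ^ (n + 1) : ℝ≥0∞) ^ p * ((c n + 1) * (e n / K n)) := by gcongr; exact le_self_add
      _ = K n * (e n / K n) := by rw [hK]; ring
      _ = e n := ENNReal.mul_div_cancel (hK0 n) (hKt n)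

end Interior

/-! ### Averaged translations -/

theorem lintegral_rpow_le_measure_mul {α : Type*} [MeasurableSpace α] {μ : Measure α}
    {p : ℝ} (hp : 1 ≤ p) {f : α → ℝ≥0∞} (hf : Measurable f) :
    (∫⁻ x, f x ∂μ) ^ p ≤ μ univ ^ (p - 1) * ∫⁻ x, f x ^ p ∂μ := by
  have hp0 : 0 < p := by linarith
  have h := eLpNorm_le_eLpNorm_mul_rpow_measure_univ (μ := μ) (p := 1) (q := ENNReal.ofReal p)
    (by simpa using hp) hf.aestronglyMeasurable
  rw [eLpNorm_one_eq_lintegral_enorm, eLpNorm_eq_lintegral_rpow_enorm_toReal (by simpa using hp0)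
    (by simp), ENNReal.toReal_ofReal hp0.le] at h
  simp only [enorm_eq_self, ENNReal.toReal_one] at h
  refine (ENNReal.rpow_le_rpow h hp0.le).trans_eq ?_
  rw [ENNReal.mul_rpow_of_nonneg _ _ hp0.le, ← ENNReal.rpow_mul, ← ENNReal.rpow_mul, mul_comm]
  congr 2
  · field_simp
  · rw [one_div, inv_mul_cancel₀ hp0.ne', ENNReal.rpow_one]

/-- A smooth probability density supported in the ball of radius `κ` about `e`. -/
structure IsMollifier (e : E) (κ : ℝ) (ρ : E → ℝ) : Prop where
  contDiff : ContDiff ℝ ∞ ρ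
  nonneg : ∀ v, 0 ≤ ρ v
  integral_eq_one : ∫ v, ρ v = 1
  eq_zero : ∀ v, v ∉ ball e κ → ρ v = 0

/-- The average of the translates `x ↦ w (x + t v)` over `v`, with density `ρ`. For a density
concentrated near a unit vector `e` this is a translation by `t e` followed by a mollification at a
scale comparable to `t`. -/
def shiftAverage (ρ w : E → ℝ) (t : ℝ) (x : E) : ℝ := ∫ v, ρ v * w (x + t • v)

theorem exists_isMollifier [(volume : Measure E).IsAddHaarMeasure] (e : E) {κ : ℝ} (hκ : 0 < κ) :
    ∃ ρ, IsMollifier e κ ρ := by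
  let φ : ContDiffBump e := ⟨κ / 2, κ, by positivity, by linarith⟩
  refine ⟨φ.normed volume, φ.contDiff_normed, φ.nonneg_normed, φ.integral_normed, fun v hv => ?_⟩
  by_contra h
  exact hv (φ.support_normed_eq (μ := volume) ▸ Function.mem_support.2 h)

section Average

variable [(volume : Measure E).IsAddHaarMeasure] {D A B : Set E} {δ q p κ t : ℝ} {w ρ : E → ℝ}
  {e : E}

theorem IsMollifier.hasCompactSupport (hρ : IsMollifier e κ ρ) : HasCompactSupport ρ :=
  HasCompactSupport.intro (isCompact_closedBall e κ) fun v hv =>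
    hρ.eq_zero v fun h => hv (ball_subset_closedBall h)

theorem IsMollifier.integrable (hρ : IsMollifier e κ ρ) : Integrable ρ :=
  hρ.contDiff.continuous.integrable_of_hasCompactSupport hρ.hasCompactSupport

theorem IsMollifier.lintegral_eq_one (hρ : IsMollifier e κ ρ) :
    ∫⁻ v, ENNReal.ofReal (ρ v) = 1 := by
  rw [← ofReal_integral_eq_lintegral_ofReal hρ.integrable (.of_forall hρ.nonneg),
    hρ.integral_eq_one, ENNReal.ofReal_one]

/-- Jensen's inequality for the average with density `ρ`. -/
theorem IsMollifier.enorm_integral_rpow_le (hρ : IsMollifier e κ ρ) (hp : 1 ≤ p) {f : E → ℝ}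
    (hf : Measurable f) :
    ‖∫ v, ρ v * f v‖ₑ ^ p ≤ ∫⁻ v, ENNReal.ofReal (ρ v) * ‖f v‖ₑ ^ p := by
  have hρm : Measurable fun v => ENNReal.ofReal (ρ v) :=
    hρ.contDiff.continuous.measurable.ennreal_ofReal
  have h1 : ‖∫ v, ρ v * f v‖ₑ ≤
      ∫⁻ v, ‖f v‖ₑ ∂(volume.withDensity fun v => ENNReal.ofReal (ρ v)) := by
    rw [lintegral_withDensity_eq_lintegral_mul _ hρm hf.enorm]
    refine (enorm_integral_le_lintegral_enorm _).trans_eq (lintegral_congr fun v => ?_)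
    rw [enorm_mul, Real.enorm_of_nonneg (hρ.nonneg v), Pi.mul_apply]
  refine (ENNReal.rpow_le_rpow h1 (by linarith)).trans
    ((lintegral_rpow_le_measure_mul hp hf.enorm).trans_eq ?_)
  rw [withDensity_apply _ MeasurableSet.univ, Measure.restrict_univ, hρ.lintegral_eq_one,
    ENNReal.one_rpow, one_mul, lintegral_withDensity_eq_lintegral_mul _ hρm (hf.enorm.pow_const _)]
  rfl

theorem integrable_rescaled_mul (hρ : IsMollifier e κ ρ) (hw : LocallyIntegrable w) (ht : t ≠ 0)
    (x : E) : Integrable fun z => ρ (t⁻¹ • (z - x)) * w z := by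
  have hc : Continuous fun z => ρ (t⁻¹ • (z - x)) := hρ.contDiff.continuous.comp (by fun_prop)
  refine hw.integrable_smul_left_of_hasCompactSupport hc ?_
  exact hρ.hasCompactSupport.comp_homeomorph
    ((Homeomorph.subRight x).trans (Homeomorph.smulOfNeZero t⁻¹ (inv_ne_zero ht)))

theorem integrable_mul_shift (hρ : IsMollifier e κ ρ) (hw : LocallyIntegrable w) (ht : t ≠ 0)
    (x : E) : Integrable fun v => ρ v * w (x + t • v) := by
  have h := ((integrable_rescaled_mul hρ hw ht x).comp_add_left x).comp_smul ht
  simpa [smul_smul, inv_mul_cancel₀ ht] using h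

theorem shiftAverage_eq (ρ w : E → ℝ) (ht : 0 < t) (x : E) :
    shiftAverage ρ w t x =
      (t ^ Module.finrank ℝ E)⁻¹ * ∫ z, ρ (t⁻¹ • (z - x)) * w z := by
  have h1 := Measure.integral_comp_smul volume
    (fun v => ρ (t⁻¹ • ((x + v) - x)) * w (x + v)) t
  have h2 := integral_add_left_eq_self (μ := (volume : Measure E))
    (fun z => ρ (t⁻¹ • (z - x)) * w z) x
  rw [h2] at h1
  simp only [add_sub_cancel_left, smul_smul, inv_mul_cancel₀ ht.ne', one_smul] at h1
  rw [shiftAverage, h1, smul_eq_mul, abs_of_pos (by positivity)]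

theorem contDiff_shiftAverage (hρ : IsMollifier e κ ρ) (hw : LocallyIntegrable w) (ht : 0 < t) :
    ContDiff ℝ ∞ (shiftAverage ρ w t) := by
  have hc : ContDiff ℝ ∞ fun z : E => ρ (t⁻¹ • (-z)) :=
    hρ.contDiff.comp (contDiff_const_smul _ |>.comp contDiff_neg)
  have hcs : HasCompactSupport fun z : E => ρ (t⁻¹ • (-z)) :=
    hρ.hasCompactSupport.comp_homeomorph
      ((Homeomorph.neg E).trans (Homeomorph.smulOfNeZero t⁻¹ (inv_ne_zero ht.ne')))
  have h := hcs.contDiff_convolution_right (n := ⊤) (ContinuousLinearMap.mul ℝ ℝ) hw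
    (μ := volume) hc
  have heq : shiftAverage ρ w t = fun x => (t ^ Module.finrank ℝ E)⁻¹ *
      convolution w (fun z => ρ (t⁻¹ • (-z))) (ContinuousLinearMap.mul ℝ ℝ) volume x := by
    funext x
    rw [shiftAverage_eq ρ w ht]
    congr 1
    refine integral_congr_ae (.of_forall fun z => ?_)
    simp [mul_comm]
  rw [heq]
  exact contDiff_const.mul h

theorem enorm_shiftAverage_sub_rpow_le (hρ : IsMollifier e κ ρ) (hp : 1 ≤ p)
    (hw : LocallyIntegrable w) (hwm : Measurable w) (ht : t ≠ 0) (x y : E) :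
    ‖shiftAverage ρ w t x - shiftAverage ρ w t y‖ₑ ^ p ≤
      ∫⁻ v, ENNReal.ofReal (ρ v) * ‖w (x + t • v) - w (y + t • v)‖ₑ ^ p := by
  rw [shiftAverage, shiftAverage, ← integral_sub (integrable_mul_shift hρ hw ht x)
    (integrable_mul_shift hρ hw ht y)]
  simp_rw [← mul_sub]
  exact hρ.enorm_integral_rpow_le hp ((hwm.comp (by fun_prop)).sub (hwm.comp (by fun_prop)))

theorem enorm_shiftAverage_sub_self_rpow_le (hρ : IsMollifier e κ ρ) (hp : 1 ≤ p)
    (hw : LocallyIntegrable w) (hwm : Measurable w) (ht : t ≠ 0) (x : E) :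
    ‖shiftAverage ρ w t x - w x‖ₑ ^ p ≤
      ∫⁻ v, ENNReal.ofReal (ρ v) * ‖w (x + t • v) - w x‖ₑ ^ p := by
  have h : w x = ∫ v, ρ v * w x := by
    rw [integral_mul_const, hρ.integral_eq_one, one_mul]
  rw [shiftAverage]
  nth_rw 1 [h]
  rw [← integral_sub (integrable_mul_shift hρ hw ht x) (hρ.integrable.mul_const _)]
  simp_rw [← mul_sub]
  exact hρ.enorm_integral_rpow_le hp ((hwm.comp (by fun_prop)).sub_const _)

/-- Continuity of translations in `L^p`. -/
theorem tendsto_lintegral_translate (hp : 1 ≤ p) (hwm : Measurable w)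
    (hw2 : ∫⁻ x, ‖w x‖ₑ ^ p < ⊤) :
    Filter.Tendsto (fun h : E => ∫⁻ x, ‖w (x + h) - w x‖ₑ ^ p) (𝓝 0) (𝓝 0) := by
  have hp0 : 0 < p := by linarith
  have hL := memLp_of_lintegral_lt_top hp hwm hw2
  have : Fact (1 ≤ ENNReal.ofReal p) := ⟨by simpa using hp⟩
  let g : C(E, C(E, E)) := ContinuousMap.curry ⟨fun z : E × E => z.2 + z.1, by fun_prop⟩
  have hg (h : E) : MeasurePreserving (g h) volume volume :=
    measurePreserving_add_right volume h
  have h1 := Filter.Tendsto.compMeasurePreservingLp (μ := (volume : Measure E))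
    (tendsto_const_nhds (x := hL.toLp w) (f := 𝓝 (0 : E)))
    (g.continuous.tendsto 0) hg (hg 0) (by simp)
  rw [tendsto_iff_edist_tendsto_0] at h1
  have h2 := h1.ennrpow_const p
  rw [ENNReal.zero_rpow_of_pos hp0] at h2
  refine h2.congr fun h => ?_
  rw [Lp.toLp_compMeasurePreserving hL (hg h), Lp.toLp_compMeasurePreserving hL (hg 0),
    Lp.edist_toLp_toLp, eLpNorm_rpow_eq hp]
  simp [g]

theorem tendsto_lintegral_shiftAverage (hρ : IsMollifier e κ ρ) (hp : 1 ≤ p) (hwm : Measurable w)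
    (hw : LocallyIntegrable w) (hw2 : ∫⁻ x, ‖w x‖ₑ ^ p < ⊤) {ε : ℝ≥0∞} (hε : ε ≠ 0) :
    ∀ᶠ t in 𝓝[>] (0 : ℝ), ∫⁻ x, ‖shiftAverage ρ w t x - w x‖ₑ ^ p ≤ ε := by
  obtain ⟨r, hr, hrw⟩ := Metric.eventually_nhds_iff_ball.1
    ((ENNReal.tendsto_nhds_zero.1 (tendsto_lintegral_translate hp hwm hw2)) ε hε.bot_lt)
  have hlim : Filter.Tendsto (fun t : ℝ => t * (‖e‖ + |κ|)) (𝓝[>] 0) (𝓝 0) := by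
    have : Filter.Tendsto (fun t : ℝ => t * (‖e‖ + |κ|)) (𝓝 0) (𝓝 (0 * (‖e‖ + |κ|))) :=
      (continuous_id.mul continuous_const).tendsto 0
    rw [zero_mul] at this
    exact this.mono_left nhdsWithin_le_nhds
  filter_upwards [hlim.eventually_lt_const hr, self_mem_nhdsWithin] with t htr ht
  have ht : 0 < t := ht
  have hm : Measurable fun z : E × E =>
      ENNReal.ofReal (ρ z.2) * ‖w (z.1 + t • z.2) - w z.1‖ₑ ^ p := by
    refine (hρ.contDiff.continuous.measurable.ennreal_ofReal.comp measurable_snd).mul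
      (Measurable.pow_const (Measurable.enorm ?_) _)
    exact (hwm.comp (by fun_prop)).sub (hwm.comp measurable_fst)
  calc _ ≤ ∫⁻ x, ∫⁻ v, ENNReal.ofReal (ρ v) * ‖w (x + t • v) - w x‖ₑ ^ p :=
        lintegral_mono fun x => enorm_shiftAverage_sub_self_rpow_le hρ hp hw hwm ht.ne' x
    _ = ∫⁻ v, ∫⁻ x, ENNReal.ofReal (ρ v) * ‖w (x + t • v) - w x‖ₑ ^ p :=
        lintegral_lintegral_swap hm.aemeasurable
    _ ≤ ∫⁻ v, ENNReal.ofReal (ρ v) * ε := by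
        refine lintegral_mono fun v => ?_
        dsimp only
        rw [lintegral_const_mul' _ _ (by simp)]
        by_cases hv : v ∈ ball e κ
        · gcongr
          refine hrw _ ?_
          rw [mem_ball_zero_iff, norm_smul, Real.norm_of_nonneg ht.le]
          refine lt_of_le_of_lt ?_ htr
          gcongr
          have h1 : ‖v‖ ≤ ‖e‖ + ‖v - e‖ := by simpa using norm_add_le e (v - e)
          have h2 : ‖v - e‖ < κ := mem_ball_iff_norm.1 hv
          have h3 := le_abs_self κ
          linarith
        · simp [hρ.eq_zero v hv]
    _ = ε := by
        rw [lintegral_mul_const _ hρ.contDiff.continuous.measurable.ennreal_ofReal,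
          hρ.lintegral_eq_one, one_mul]

/-- If translation by `t v` increases the kernel at points of `A` at most by the factor `c`, for all
`v` in the support of the density, then averaging increases the energy at most by this factor. -/
theorem energy_shiftAverage_le (hD : IsOpen D) (hρ : IsMollifier e κ ρ) (hp : 1 ≤ p)
    (hwm : Measurable w) (hw : LocallyIntegrable w) (ht : t ≠ 0) (hA : MeasurableSet A)
    (hB : MeasurableSet B) {c : ℝ≥0∞} (hc : c ≠ ⊤)
    (h : ∀ x ∈ A, ∀ v ∈ ball e κ, x + t • v ∈ B ∧
      ∀ y, kernel D δ q x y ≤ c * kernel D δ q (x + t • v) (y + t • v)) :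
    energy D δ q p A (shiftAverage ρ w t) ≤ c * energy D δ q p B w := by
  set H : E → ℝ≥0∞ := fun x => ∫⁻ y, kernel D δ q x y * ‖w x - w y‖ₑ ^ p with hH
  have hρm : Measurable fun v => ENNReal.ofReal (ρ v) :=
    hρ.contDiff.continuous.measurable.ennreal_ofReal
  have hGm : Measurable fun z : (E × E) × E => kernel D δ q z.1.1 z.1.2 *
      (ENNReal.ofReal (ρ z.2) * ‖w (z.1.1 + t • z.2) - w (z.1.2 + t • z.2)‖ₑ ^ p) := by
    refine ((measurable_kernel hD).comp measurable_fst).mul ((hρm.comp measurable_snd).mul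
      (Measurable.pow_const (Measurable.enorm ?_) _))
    exact (hwm.comp (by fun_prop)).sub (hwm.comp (by fun_prop))
  have hshift (x : E) : ∀ v, H (x + t • v) =
      ∫⁻ y, kernel D δ q (x + t • v) (y + t • v) * ‖w (x + t • v) - w (y + t • v)‖ₑ ^ p :=
    fun v => (lintegral_add_right_eq_self (μ := (volume : Measure E))
      (fun y => kernel D δ q (x + t • v) y * ‖w (x + t • v) - w y‖ₑ ^ p) (t • v)).symm
  calc energy D δ q p A (shiftAverage ρ w t)
      ≤ ∫⁻ x in A, ∫⁻ y, ∫⁻ v, kernel D δ q x y *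
          (ENNReal.ofReal (ρ v) * ‖w (x + t • v) - w (y + t • v)‖ₑ ^ p) := by
        refine lintegral_mono fun x => lintegral_mono fun y => ?_
        dsimp only
        rw [lintegral_const_mul' _ _ kernel_ne_top]
        gcongr
        exact enorm_shiftAverage_sub_rpow_le hρ hp hw hwm ht x y
    _ = ∫⁻ x in A, ∫⁻ v, ∫⁻ y, kernel D δ q x y *
          (ENNReal.ofReal (ρ v) * ‖w (x + t • v) - w (y + t • v)‖ₑ ^ p) := by
        refine lintegral_congr fun x => ?_
        refine lintegral_lintegral_swap (Measurable.aemeasurable ?_)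
        exact hGm.comp (f := fun z : E × E => ((x, z.1), z.2)) (by fun_prop)
    _ = ∫⁻ v, ∫⁻ x in A, ∫⁻ y, kernel D δ q x y *
          (ENNReal.ofReal (ρ v) * ‖w (x + t • v) - w (y + t • v)‖ₑ ^ p) := by
        refine lintegral_lintegral_swap (Measurable.aemeasurable ?_)
        exact Measurable.lintegral_prod_right' (f := fun z : (E × E) × E =>
          kernel D δ q z.1.1 z.2 * (ENNReal.ofReal (ρ z.1.2) *
            ‖w (z.1.1 + t • z.1.2) - w (z.2 + t • z.1.2)‖ₑ ^ p))
          (hGm.comp (f := fun z : (E × E) × E => ((z.1.1, z.2), z.1.2)) (by fun_prop))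
    _ ≤ ∫⁻ v, ENNReal.ofReal (ρ v) * (c * energy D δ q p B w) := by
        refine lintegral_mono fun v => ?_
        dsimp only
        by_cases hv : v ∈ ball e κ
        · calc _ ≤ ∫⁻ x in A, ENNReal.ofReal (ρ v) * (c * B.indicator H (x + t • v)) := by
                refine setLIntegral_mono' hA fun x hx => ?_
                rw [indicator_of_mem (h x hx v hv).1, hshift, ← lintegral_const_mul' _ _ hc,
                  ← lintegral_const_mul' _ _ (by simp)]
                refine lintegral_mono fun y => ?_
                dsimp only
                rw [mul_left_comm, ← mul_assoc c]
                gcongr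
                exact (h x hx v hv).2 y
            _ ≤ ∫⁻ x, ENNReal.ofReal (ρ v) * (c * B.indicator H (x + t • v)) :=
                setLIntegral_le_lintegral _ _
            _ = ENNReal.ofReal (ρ v) * (c * energy D δ q p B w) := by
                rw [lintegral_const_mul' _ _ (by simp), lintegral_const_mul' _ _ hc,
                  lintegral_add_right_eq_self (B.indicator H), lintegral_indicator hB, energy]
        · simp [hρ.eq_zero v hv]
    _ = c * energy D δ q p B w := by
        rw [lintegral_mul_const _ hρm, hρ.lintegral_eq_one, one_mul]

end Average

/-! ### Averaged translations close to the boundary -/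

section Near

variable [(volume : Measure E).IsAddHaarMeasure] {D A B : Set E} {δ q p κ t : ℝ} {w ρ : E → ℝ}
  {e : E}

theorem shiftAverage_sub_const (hρ : IsMollifier e κ ρ) (hw : LocallyIntegrable w) (ht : t ≠ 0)
    (c : ℝ) (x : E) : shiftAverage ρ (fun z => w z - c) t x = shiftAverage ρ w t x - c := by
  simp only [shiftAverage, mul_sub]
  rw [integral_sub (integrable_mul_shift hρ hw ht x) (hρ.integrable.mul_const _),
    integral_mul_const, hρ.integral_eq_one, one_mul]

/-- The average is Lipschitz at scale `t`, with a constant controlled by the oscillation of `w`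
about an arbitrary value `c` in a ball of radius comparable to `t`. -/
theorem enorm_shiftAverage_sub_rpow_le_setLIntegral (hρ : IsMollifier e κ ρ) {L : NNReal}
    (hL : LipschitzWith L ρ) (hp : 1 ≤ p) (hwm : Measurable w) (hw : LocallyIntegrable w)
    (ht : 0 < t) {x y : E} (hxy : dist y x ≤ κ * t) (c : ℝ) :
    ‖shiftAverage ρ w t x - shiftAverage ρ w t y‖ₑ ^ p ≤
      ENNReal.ofReal ((t ^ Module.finrank ℝ E)⁻¹ * (L * (dist y x / t))) ^ p *
        (volume (ball (x + t • e) (2 * κ * t)) ^ (p - 1) *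
          ∫⁻ z in ball (x + t • e) (2 * κ * t), ‖w z - c‖ₑ ^ p) := by
  have hp0 : 0 ≤ p := by linarith
  have hT : 0 < (t ^ Module.finrank ℝ E)⁻¹ := by positivity
  set U := ball (x + t • e) (2 * κ * t) with hU
  set f : E → ℝ := fun z => w z - c with hf
  have hfl : LocallyIntegrable f := hw.sub (locallyIntegrable_const c)
  have hfm : Measurable f := hwm.sub_const c
  have e1 : shiftAverage ρ w t x - shiftAverage ρ w t y = (t ^ Module.finrank ℝ E)⁻¹ *
      ∫ z, (ρ (t⁻¹ • (z - x)) - ρ (t⁻¹ • (z - y))) * f z := by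
    rw [← sub_sub_sub_cancel_right _ _ c, ← shiftAverage_sub_const hρ hw ht.ne',
      ← shiftAverage_sub_const hρ hw ht.ne', shiftAverage_eq _ _ ht, shiftAverage_eq _ _ ht,
      ← mul_sub, ← integral_sub (integrable_rescaled_mul hρ hfl ht.ne' x)
        (integrable_rescaled_mul hρ hfl ht.ne' y)]
    simp_rw [sub_mul]
  have hout {x' : E} (hx' : dist x' x ≤ κ * t) {z : E} (hz : z ∉ U) : ρ (t⁻¹ • (z - x')) = 0 := by
    refine hρ.eq_zero _ fun h => hz ?_
    rw [mem_ball_iff_norm] at h ⊢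
    have h1 : ‖z - x' - t • e‖ < κ * t := by
      have : z - x' - t • e = t • (t⁻¹ • (z - x') - e) := by
        rw [smul_sub, smul_smul, mul_inv_cancel₀ ht.ne', one_smul]
      rw [this, norm_smul, Real.norm_of_nonneg ht.le, mul_comm]
      gcongr
    have h2 : z - (x + t • e) = (z - x' - t • e) + (x' - x) := by abel
    rw [h2]
    refine (norm_add_le _ _).trans_lt ?_
    rw [← dist_eq_norm x' x]
    linarith
  have hpos : 0 ≤ κ * t := dist_nonneg.trans hxy
  have hpt (z : E) : ‖(ρ (t⁻¹ • (z - x)) - ρ (t⁻¹ • (z - y))) * f z‖ₑ ≤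
      ENNReal.ofReal (L * (dist y x / t)) * U.indicator (fun z => ‖f z‖ₑ) z := by
    by_cases hz : z ∈ U
    · rw [indicator_of_mem hz, enorm_mul]
      gcongr
      rw [Real.enorm_eq_ofReal_abs, ← Real.dist_eq]
      refine ENNReal.ofReal_le_ofReal ((hL.dist_le_mul _ _).trans_eq ?_)
      rw [dist_eq_norm (t⁻¹ • (z - x)), ← smul_sub, norm_smul, sub_sub_sub_cancel_left,
        Real.norm_of_nonneg (inv_nonneg.2 ht.le), dist_eq_norm y x]
      ring
    · rw [hout hxy hz, hout (by rwa [dist_self]) hz]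
      simp
  have h1 : ‖shiftAverage ρ w t x - shiftAverage ρ w t y‖ₑ ≤
      ENNReal.ofReal ((t ^ Module.finrank ℝ E)⁻¹ * (L * (dist y x / t))) *
        ∫⁻ z in U, ‖f z‖ₑ := by
    rw [e1, enorm_mul, Real.enorm_of_nonneg hT.le, ENNReal.ofReal_mul hT.le, mul_assoc]
    gcongr
    refine (enorm_integral_le_lintegral_enorm _).trans ((lintegral_mono hpt).trans_eq ?_)
    rw [lintegral_const_mul' _ _ ENNReal.ofReal_ne_top, lintegral_indicator measurableSet_ball]
  refine (ENNReal.rpow_le_rpow h1 hp0).trans ?_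
  rw [ENNReal.mul_rpow_of_nonneg _ _ hp0]
  gcongr
  refine (lintegral_rpow_le_measure_mul hp hfm.enorm).trans_eq ?_
  rw [Measure.restrict_apply_univ]

/-- The bookkeeping of powers in the estimate close to the boundary: every power of `t` cancels
up to `t^(-n)`, and `τ` enters with the nonnegative exponent `n + p - q`. -/
theorem near_constant_le {n : ℕ} {L V a τ : ℝ} (hq : q ≤ n + p) (ht : 0 < t) (hτ : 0 < τ)
    (hτt : τ ≤ t) (hL : 0 ≤ L) (hV : 0 < V) (ha : 0 < a) :
    τ ^ (-q) * (τ ^ n * V) * ((((t ^ n)⁻¹ * (L * (τ / t))) ^ p *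
      ((a * t ^ n * V) ^ (p - 1) * (3 * t) ^ q)) / (a * t ^ n * V)) ≤
      (V * L ^ p * (a * V) ^ (p - 1) * 3 ^ q / (a * V)) * (t ^ n)⁻¹ := by
  have hT : 0 < t ^ n := by positivity
  set T := t ^ n with hTdef
  have h1 : τ ^ (-q) * τ ^ n * τ ^ p ≤ t ^ (-q) * T * t ^ p := by
    rw [hTdef, ← Real.rpow_natCast, ← Real.rpow_natCast, ← Real.rpow_add hτ, ← Real.rpow_add hτ,
      ← Real.rpow_add ht, ← Real.rpow_add ht]
    exact Real.rpow_le_rpow hτ.le hτt (by linarith)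
  have e1 : (T⁻¹ * (L * (τ / t))) ^ p = (T ^ p)⁻¹ * (L ^ p * (τ ^ p * (t ^ p)⁻¹)) := by
    rw [Real.mul_rpow (by positivity) (by positivity), Real.mul_rpow hL (by positivity),
      Real.div_rpow hτ.le ht.le, Real.inv_rpow hT.le, div_eq_mul_inv]
  have e2 : (a * T * V) ^ (p - 1) = (a * V) ^ (p - 1) * (T ^ p * T⁻¹) := by
    rw [show a * T * V = (a * V) * T by ring, Real.mul_rpow (by positivity) hT.le,
      Real.rpow_sub_one hT.ne', div_eq_mul_inv]
  have e3 : (3 * t) ^ q = 3 ^ q * t ^ q := Real.mul_rpow (by norm_num) ht.le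
  have e4 : t ^ (-q) = (t ^ q)⁻¹ := Real.rpow_neg ht.le _
  have hTp : 0 < T ^ p := by positivity
  have htp : 0 < t ^ p := by positivity
  have htq : 0 < t ^ q := by positivity
  calc _ = (τ ^ (-q) * τ ^ n * τ ^ p) * (V * ((T ^ p)⁻¹ * (L ^ p * (t ^ p)⁻¹)) *
        ((a * V) ^ (p - 1) * (T ^ p * T⁻¹) * (3 ^ q * t ^ q)) / (a * T * V)) := by
        rw [e1, e2, e3]; ring
    _ ≤ (t ^ (-q) * T * t ^ p) * (V * ((T ^ p)⁻¹ * (L ^ p * (t ^ p)⁻¹)) *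
        ((a * V) ^ (p - 1) * (T ^ p * T⁻¹) * (3 ^ q * t ^ q)) / (a * T * V)) := by
        gcongr
    _ = _ := by
        rw [e4]
        field_simp

/-- The energy of the average at points `x` whose distance to the boundary is small compared to `t`,
while the ball of radius `2 κ t` about `x + t e` lies so deep in `D` that all pairs of its points
are seen by the kernel. The constant does not depend on `t`. -/
theorem exists_energy_shiftAverage_le_near (hD : IsOpen D) (hD' : Dᶜ.Nonempty)
    (hρ : IsMollifier e κ ρ) (hp : 1 ≤ p) (hδ : δ ≤ 1) (hq0 : 0 ≤ q)
    (hq : q ≤ Module.finrank ℝ E + p) (hκ : 0 < κ) (hκ1 : κ ≤ 1) :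
    ∃ c : ℝ≥0∞, c ≠ ⊤ ∧ ∀ w : E → ℝ, Measurable w → LocallyIntegrable w → ∀ t : ℝ, 0 < t →
      ∀ A B : Set E, MeasurableSet A → MeasurableSet B →
      (∀ x ∈ A, x ∈ D ∧ infDist x Dᶜ ≤ κ * t ∧ ∀ z ∈ ball (x + t • e) (2 * κ * t),
        z ∈ B ∧ z ∈ D ∧ 4 * κ * t ≤ δ * infDist z Dᶜ ∧ infDist z Dᶜ ≤ 3 * t) →
      energy D δ q p A (shiftAverage ρ w t) ≤ c * energy D δ q p B w := by
  have hp0 : 0 ≤ p := by linarith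
  obtain ⟨L, hL⟩ := hρ.contDiff.lipschitzWith_of_hasCompactSupport hρ.hasCompactSupport (by simp)
  set n := Module.finrank ℝ E with hn
  set V := (volume (ball (0 : E) 1)).toReal with hVdef
  have hVt : volume (ball (0 : E) 1) = ENNReal.ofReal V :=
    (ENNReal.ofReal_toReal measure_ball_lt_top.ne).symm
  have hV : 0 < V := ENNReal.toReal_pos (measure_ball_pos _ _ one_pos).ne' measure_ball_lt_top.ne
  set a : ℝ := (2 * κ) ^ n with ha_def
  have ha : 0 < a := by positivity
  set C : ℝ := V * L ^ p * (a * V) ^ (p - 1) * 3 ^ q / (a * V) with hC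
  have hC0 : 0 ≤ C := by positivity
  refine ⟨ENNReal.ofReal (C * (a * V)), ENNReal.ofReal_ne_top,
    fun w hwm hw t ht A B hA hB h => ?_⟩
  have hvol (x : E) : volume (ball x (2 * κ * t)) = ENNReal.ofReal (a * t ^ n * V) := by
    rw [volume_ball_eq x (by positivity), hVt, ← ENNReal.ofReal_mul (by positivity), mul_pow]
  set H : E → ℝ≥0∞ := fun x => ∫⁻ y, kernel D δ q x y * ‖w x - w y‖ₑ ^ p with hH
  have hHm : Measurable H := measurable_energy_inner hD hwm
  set J : E → ℝ≥0∞ := fun x => ∫⁻ z, {z | dist z (x + t • e) < 2 * κ * t}.indicator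
    (B.indicator H) z with hJ
  -- the oscillation of `w` about its value at a point `z` of the ball is part of the energy
  have hosc : ∀ x ∈ A, ∀ z ∈ ball (x + t • e) (2 * κ * t),
      ∫⁻ z' in ball (x + t • e) (2 * κ * t), ‖w z' - w z‖ₑ ^ p ≤
        ENNReal.ofReal ((3 * t) ^ q) * H z := by
    intro x hx z hz
    obtain ⟨-, hzD, hz1, hz2⟩ := (h x hx).2.2 z hz
    have hzpos := infDist_compl_pos hD hD' hzD
    rw [← lintegral_const_mul' _ _ ENNReal.ofReal_ne_top]
    refine (setLIntegral_mono' measurableSet_ball fun z' hz' => ?_).trans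
      (setLIntegral_le_lintegral _ _)
    have hd : dist z' z < δ * infDist z Dᶜ := by
      have := dist_triangle_right z' z (x + t • e)
      have := mem_ball.1 hz
      have := mem_ball.1 hz'
      linarith
    rw [kernel_of_mem hzD hd, ← mul_assoc, ← ENNReal.ofReal_mul (by positivity),
      ← edist_eq_enorm_sub, edist_comm, edist_eq_enorm_sub]
    refine le_mul_of_one_le_left' ?_
    rw [ENNReal.one_le_ofReal, Real.rpow_neg hzpos.le, ← div_eq_mul_inv,
      one_le_div (by positivity)]
    exact Real.rpow_le_rpow hzpos.le hz2 hq0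
  -- the Lipschitz bound with `c = w z`, averaged over the points `z` of the ball
  have hpt : ∀ x ∈ A, ∀ y, dist y x < δ * infDist x Dᶜ →
      ‖shiftAverage ρ w t x - shiftAverage ρ w t y‖ₑ ^ p ≤
        ENNReal.ofReal ((((t ^ n)⁻¹ * (L * (infDist x Dᶜ / t))) ^ p *
          ((a * t ^ n * V) ^ (p - 1) * (3 * t) ^ q)) / (a * t ^ n * V)) * J x := by
    intro x hx y hy
    obtain ⟨hxD, hxt, hxB⟩ := h x hx
    have hxpos := infDist_compl_pos hD hD' hxD
    have hyx : dist y x ≤ infDist x Dᶜ :=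
      hy.le.trans (mul_le_of_le_one_left infDist_nonneg hδ)
    set U := ball (x + t • e) (2 * κ * t) with hU
    set F := ‖shiftAverage ρ w t x - shiftAverage ρ w t y‖ₑ ^ p with hF
    set X : ℝ := ((t ^ n)⁻¹ * (L * (infDist x Dᶜ / t))) ^ p *
          ((a * t ^ n * V) ^ (p - 1) * (3 * t) ^ q) with hX
    have hF1 : ∀ z ∈ U, F ≤ ENNReal.ofReal X * H z := by
      intro z hz
      refine (enorm_shiftAverage_sub_rpow_le_setLIntegral hρ hL hp hwm hw ht
        (hyx.trans hxt) (w z)).trans ?_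
      rw [hvol, ENNReal.ofReal_rpow_of_nonneg (by positivity) hp0,
        ENNReal.ofReal_rpow_of_pos (by positivity), ← hn, hX, ENNReal.ofReal_mul (by positivity),
        ENNReal.ofReal_mul (by positivity), mul_assoc (ENNReal.ofReal (_ ^ p)),
        mul_assoc (ENNReal.ofReal (_ ^ (p - 1)))]
      gcongr
      exact hosc x hx z hz
    have hF2 : F * ENNReal.ofReal (a * t ^ n * V) ≤ ENNReal.ofReal X * J x := by
      calc F * ENNReal.ofReal (a * t ^ n * V) = ∫⁻ _ in U, F := by
            rw [setLIntegral_const, hvol]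
        _ ≤ ∫⁻ z in U, ENNReal.ofReal X * B.indicator H z := by
            refine setLIntegral_mono' measurableSet_ball fun z hz => ?_
            rw [indicator_of_mem (hxB z hz).1]
            exact hF1 z hz
        _ = ENNReal.ofReal X * J x := by
            rw [lintegral_const_mul' _ _ ENNReal.ofReal_ne_top, hJ]
            dsimp only
            rw [← lintegral_indicator measurableSet_ball]
            rfl
    have hpos : 0 < a * t ^ n * V := by positivity
    rw [← ENNReal.le_div_iff_mul_le (by simp [hpos]) (by simp)] at hF2
    refine hF2.trans_eq ?_
    rw [ENNReal.ofReal_div_of_pos hpos, ENNReal.mul_div_right_comm]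
  have hin : ∀ x ∈ A, ∫⁻ y, kernel D δ q x y *
      ‖shiftAverage ρ w t x - shiftAverage ρ w t y‖ₑ ^ p ≤
        ENNReal.ofReal (C * (t ^ n)⁻¹) * J x := by
    intro x hx
    obtain ⟨hxD, hxt, hxB⟩ := h x hx
    have hxpos := infDist_compl_pos hD hD' hxD
    set P : ℝ := (((t ^ n)⁻¹ * (L * (infDist x Dᶜ / t))) ^ p *
          ((a * t ^ n * V) ^ (p - 1) * (3 * t) ^ q)) / (a * t ^ n * V) with hP
    have hP0 : 0 ≤ P := by positivity
    calc _ ≤ ∫⁻ y, (ball x (infDist x Dᶜ)).indicator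
          (fun _ => ENNReal.ofReal (infDist x Dᶜ ^ (-q)) * (ENNReal.ofReal P * J x)) y := by
          refine lintegral_mono fun y => ?_
          by_cases hy : dist y x < δ * infDist x Dᶜ
          · rw [indicator_of_mem (mem_ball.2
              (hy.trans_le (mul_le_of_le_one_left infDist_nonneg hδ))), kernel_of_mem hxD hy]
            gcongr
            exact hpt x hx y hy
          · simp [kernel_of_notMem (fun h' => hy h'.2)]
      _ = ENNReal.ofReal (infDist x Dᶜ ^ (-q) * (infDist x Dᶜ ^ n * V) * P) * J x := by
          rw [lintegral_indicator_const measurableSet_ball, volume_ball_eq x hxpos, ← hn, hVt,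
            ENNReal.ofReal_mul (by positivity), ENNReal.ofReal_mul (by positivity),
            ENNReal.ofReal_mul (by positivity)]
          ring
      _ ≤ ENNReal.ofReal (C * (t ^ n)⁻¹) * J x := by
          refine mul_le_mul' (ENNReal.ofReal_le_ofReal ?_) le_rfl
          exact near_constant_le hq ht hxpos (hxt.trans (mul_le_of_le_one_left ht.le hκ1))
            L.coe_nonneg hV ha
  have hJm : Measurable fun z : E × E => {z' | dist z' (z.1 + t • e) < 2 * κ * t}.indicator
      (B.indicator H) z.2 := by
    have hset : MeasurableSet {z : E × E | dist z.2 (z.1 + t • e) < 2 * κ * t} :=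
      measurableSet_lt (by fun_prop) measurable_const
    exact ((hHm.indicator hB).comp measurable_snd).indicator hset
  calc energy D δ q p A (shiftAverage ρ w t)
      ≤ ∫⁻ x in A, ENNReal.ofReal (C * (t ^ n)⁻¹) * J x := setLIntegral_mono' hA hin
    _ ≤ ∫⁻ x, ENNReal.ofReal (C * (t ^ n)⁻¹) * J x := setLIntegral_le_lintegral _ _
    _ = ENNReal.ofReal (C * (t ^ n)⁻¹) * ∫⁻ z, ∫⁻ x,
          {z' | dist z' (x + t • e) < 2 * κ * t}.indicator (B.indicator H) z := by
        rw [lintegral_const_mul' _ _ ENNReal.ofReal_ne_top, hJ,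
          lintegral_lintegral_swap hJm.aemeasurable]
    _ = ENNReal.ofReal (C * (t ^ n)⁻¹) * ∫⁻ z, B.indicator H z *
          ENNReal.ofReal (a * t ^ n * V) := by
        congr 1
        refine lintegral_congr fun z => ?_
        rw [← hvol (z - t • e), ← lintegral_indicator_const measurableSet_ball]
        refine lintegral_congr fun x => ?_
        have : dist z (x + t • e) = dist x (z - t • e) := by
          rw [dist_eq_norm, dist_eq_norm, ← norm_neg]; congr 1; abel
        simp only [indicator, mem_ball, mem_ofPred_eq, this]
    _ = ENNReal.ofReal (C * (a * V)) * energy D δ q p B w := by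
        rw [lintegral_mul_const _ (hHm.indicator hB), lintegral_indicator hB, mul_left_comm,
          ← ENNReal.ofReal_mul (by positivity), mul_comm, energy]
        congr 2
        field_simp

end Near

/-! ### Smooth approximation near a boundary point with an interior cone -/

/-- Inside the ball `B(z, r)`, translations by vectors of the cone generated by `B(e, κ)` do not
leave `D`. -/
def ConeCondition (D : Set E) (z e : E) (r κ : ℝ) : Prop :=
  ∀ x ∈ D, x ∈ ball z r → ∀ t : ℝ, 0 < t → ∀ v ∈ ball e κ, x + t • v ∈ ball z r → x + t • v ∈ D

/-- Smooth functions on the whole space approximate `w` both in `L^p` and in the energy. -/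
def SmoothlyApproximable (D : Set E) (δ q p : ℝ) (w : E → ℝ) : Prop :=
  ∀ ε : ℝ≥0∞, ε ≠ 0 → ∃ v : E → ℝ, ContDiff ℝ ∞ v ∧ ∫⁻ x, ‖v x - w x‖ₑ ^ p ≤ ε ∧
    energy D δ q p univ (fun x => v x - w x) ≤ ε

section Cone

variable {D : Set E} {δ q p κ r t : ℝ} {w ρ : E → ℝ} {z e : E}

theorem mem_of_infDist_compl_pos {x : E} (h : 0 < infDist x Dᶜ) : x ∈ D := by
  by_contra hx
  exact h.ne' (infDist_zero_of_mem hx)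

theorem le_infDist_compl (hD' : Dᶜ.Nonempty) {x : E} {a : ℝ} (h : ball x a ⊆ D) :
    a ≤ infDist x Dᶜ := by
  refine (le_infDist hD').2 fun y hy => ?_
  by_contra hlt
  exact hy (h (mem_ball'.2 (not_le.1 hlt)))

/-- Translation in a direction of the cone does not decrease the distance to the boundary. -/
theorem ConeCondition.infDist_compl_le (h : ConeCondition D z e r κ) (hD' : Dᶜ.Nonempty) {x v : E}
    (hv : v ∈ ball e κ) (ht : 0 < t) (hx : dist x z + ‖t • v‖ + infDist x Dᶜ ≤ r) :
    infDist x Dᶜ ≤ infDist (x + t • v) Dᶜ := by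
  refine le_infDist_compl hD' fun y hy => ?_
  have hy' : dist (y - t • v) x < infDist x Dᶜ := by
    have := mem_ball.1 hy
    rwa [dist_eq_norm, sub_add_eq_sub_sub, sub_right_comm, ← dist_eq_norm] at this
  have h0 := norm_nonneg (t • v)
  have h1 : dist (y - t • v) z < r - ‖t • v‖ := by
    have := dist_triangle (y - t • v) x z
    linarith
  have h2 : dist y z < r := by
    have h3 := dist_triangle y (y - t • v) z
    rw [dist_self_sub_right] at h3
    linarith
  have := h (y - t • v) (ball_infDist_compl_subset (mem_ball.2 hy')) (mem_ball.2 (by linarith)) t ht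
    v hv (by rwa [sub_add_cancel, mem_ball])
  rwa [sub_add_cancel] at this

theorem ConeCondition.mul_le_infDist_compl (h : ConeCondition D z e r κ) (hD' : Dᶜ.Nonempty) {x : E}
    (hxD : x ∈ D) (ht : 0 < t) (hκ : 0 ≤ κ) (hx : dist x z + ‖t • e‖ + κ * t ≤ r) :
    κ * t ≤ infDist (x + t • e) Dᶜ := by
  refine le_infDist_compl hD' fun y hy => ?_
  have hy' : ‖y - x - t • e‖ < κ * t := by
    have := mem_ball.1 hy
    rwa [dist_eq_norm, sub_add_eq_sub_sub] at this
  have h0 := norm_nonneg (t • e)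
  have h1 : 0 ≤ κ * t := by positivity
  have hxy : x + t • (t⁻¹ • (y - x)) = y := by
    rw [smul_smul, mul_inv_cancel₀ ht.ne', one_smul, add_sub_cancel]
  have hv : t⁻¹ • (y - x) ∈ ball e κ := by
    have h2 : y - x - t • e = t • (t⁻¹ • (y - x) - e) := by
      rw [smul_sub, smul_smul, mul_inv_cancel₀ ht.ne', one_smul]
    rw [h2, norm_smul, Real.norm_of_nonneg ht.le, mul_comm] at hy'
    exact mem_ball_iff_norm.2 (lt_of_mul_lt_mul_right hy' ht.le)
  have hyz : dist y z < r := by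
    have h2 := dist_triangle4 y (x + t • e) x z
    have h3 := mem_ball.1 hy
    rw [dist_self_add_left] at h2
    linarith
  have hxz : dist x z ≤ r := by linarith
  rcases hxz.lt_or_eq with hxz | hxz
  · have := h x hxD (mem_ball.2 hxz) t ht _ hv (by rwa [hxy, mem_ball])
    rwa [hxy] at this
  · exact absurd (hy'.trans_le (by linarith)) (not_lt.2 (norm_nonneg _))

variable [(volume : Measure E).IsAddHaarMeasure]

/-- The energy of the average in the layer of width `η` is bounded by the energy of the function
in the layer of width `3 η`, uniformly in `t ≤ η`. At distance more than a multiple of `t` from the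
boundary, translation along the cone is harmless to the kernel; closer to the boundary, the average
is smooth at a scale larger than the radius of the kernel. -/
theorem ConeCondition.exists_energy_shiftAverage_le (h : ConeCondition D z e r κ) (hD : IsOpen D)
    (hD' : Dᶜ.Nonempty) (he : ‖e‖ = 1) (hκ : 0 < κ) (hκ1 : κ ≤ 1) (hδ0 : 0 < δ)
    (hδ : δ ≤ 1) (hρ : IsMollifier e (δ * κ / 6) ρ) (hp : 1 ≤ p) (hq0 : 0 ≤ q)
    (hq : q ≤ Module.finrank ℝ E + p) :
    ∃ c : ℝ≥0∞, c ≠ ⊤ ∧ ∀ w : E → ℝ, Measurable w → LocallyIntegrable w →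
      (∀ x, r / 4 ≤ dist x z → w x = 0) → ∀ t η : ℝ, 0 < t → t ≤ η → η ≤ r / 16 →
      energy D δ q p {x | infDist x Dᶜ < η} (shiftAverage ρ w t) ≤
        c * energy D δ q p {x | infDist x Dᶜ < 3 * η} w := by
  set m := δ * κ / 6 with hm
  have hm0 : 0 < m := by positivity
  have hδκ : δ * κ ≤ κ := mul_le_of_le_one_left hκ.le hδ
  have hm1 : m ≤ κ / 6 := by linarith
  obtain ⟨c, hc, hnear⟩ := exists_energy_shiftAverage_le_near hD hD' hρ hp hδ hq0 hq hm0
    (by linarith)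
  set b : ℝ := (1 + 2 / m) ^ q with hb
  refine ⟨ENNReal.ofReal b + c, by finiteness, fun w hwm hw hw0 t η ht htη hηr => ?_⟩
  have hτc : Continuous fun x : E => infDist x Dᶜ := continuous_infDist_pt _
  have hzc : Continuous fun x : E => dist x z := by fun_prop
  have hle (a : ℝ) : MeasurableSet {x : E | infDist x Dᶜ < a} :=
    measurableSet_lt hτc.measurable measurable_const
  have hvn {v : E} (hv : v ∈ ball e m) : ‖t • v‖ ≤ 2 * t := by
    have h1 : ‖v‖ ≤ ‖e‖ + ‖v - e‖ := by simpa using norm_add_le e (v - e)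
    have h2 : ‖v - e‖ < m := mem_ball_iff_norm.1 hv
    rw [norm_smul, Real.norm_of_nonneg ht.le, mul_comm]
    gcongr
    linarith
  have hvκ {v : E} (hv : v ∈ ball e m) : v ∈ ball e κ :=
    ball_subset_ball (by linarith) hv
  have hte : ‖t • e‖ = t := by rw [norm_smul, he, mul_one, Real.norm_of_nonneg ht.le]
  set A := {x : E | infDist x Dᶜ < η} with hA
  set B := {x : E | infDist x Dᶜ < 3 * η} with hB
  -- the layer splits into `A₀`, away from `z` (or outside `D`), and two parts near `z`: in `A₁` the
  -- distance to the boundary is at least `m t`, in `A₂` it is at most `m t`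
  set A₁ := {x : E | infDist x Dᶜ < η ∧ dist x z < r / 2 ∧ m * t ≤ infDist x Dᶜ} with hA₁
  set A₂ := {x : E | x ∈ D ∧ dist x z < r / 2 ∧ infDist x Dᶜ ≤ m * t} with hA₂
  set A₀ := {x : E | infDist x Dᶜ < η ∧ (x ∈ D → r / 2 ≤ dist x z)} with hA₀
  have hA₁m : MeasurableSet A₁ := (hle _).inter
    ((measurableSet_lt hzc.measurable measurable_const).inter
      (measurableSet_le measurable_const hτc.measurable))
  have hA₂m : MeasurableSet A₂ := hD.measurableSet.inter
    ((measurableSet_lt hzc.measurable measurable_const).inter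
      (measurableSet_le hτc.measurable measurable_const))
  have hA₀m : MeasurableSet A₀ := by
    have : A₀ = {x : E | infDist x Dᶜ < η} ∩ (Dᶜ ∪ {x : E | r / 2 ≤ dist x z}) := by
      ext x; simp only [hA₀, mem_ofPred_eq, mem_inter_iff, mem_union, mem_compl_iff, imp_iff_not_or]
    rw [this]
    exact (hle _).inter (hD.measurableSet.compl.union
      (measurableSet_le measurable_const hzc.measurable))
  -- the kernel vanishes outside `D`, and the average vanishes at and near the points of `A₀` in `D`
  have h0 : energy D δ q p A₀ (shiftAverage ρ w t) = 0 := by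
    refine energy_eq_zero (by linarith) hA₀m fun x hx hxD y hy => ?_
    have hz : ∀ y', r / 2 - r / 16 ≤ dist y' z → shiftAverage ρ w t y' = 0 := by
      intro y' hy'
      refine integral_eq_zero_of_ae (.of_forall fun v => ?_)
      by_cases hv : v ∈ ball e m
      · have h1 := dist_triangle y' (y' + t • v) z
        rw [dist_self_add_right] at h1
        have h2 := hvn hv
        simp [hw0 (y' + t • v) (by linarith)]
      · simp [hρ.eq_zero v hv]
    have hxz := hx.2 hxD
    have hyx : dist y x ≤ infDist x Dᶜ := hy.le.trans (mul_le_of_le_one_left infDist_nonneg hδ)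
    have := dist_triangle_left x z y
    have hx1 : infDist x Dᶜ < η := hx.1
    rw [hz x (by linarith), hz y (by linarith)]
  -- on `A₁`, the shift by `t v` changes the distance to the boundary by a factor in
  -- `[1, 1 + 2 / m]`
  have h1 : energy D δ q p A₁ (shiftAverage ρ w t) ≤ ENNReal.ofReal b * energy D δ q p B w := by
    refine energy_shiftAverage_le hD hρ hp hwm hw ht.ne' hA₁m (hle _) ENNReal.ofReal_ne_top
      fun x hx v hv => ?_
    obtain ⟨hx1, hx2, hx3⟩ := hx
    have hv2 := hvn hv
    have hpos : 0 < infDist x Dᶜ := (mul_pos hm0 ht).trans_le hx3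
    have hmono := h.infDist_compl_le hD' (hvκ hv) ht (x := x) (by linarith)
    have hup : infDist (x + t • v) Dᶜ ≤ infDist x Dᶜ + 2 * t := by
      have := infDist_le_add Dᶜ (x + t • v) x
      rw [dist_self_add_left] at this
      linarith
    refine ⟨?_, fun y => ?_⟩
    · change infDist (x + t • v) Dᶜ < 3 * η
      linarith
    · by_cases hy : dist y x < δ * infDist x Dᶜ
      · rw [kernel_of_mem (mem_of_infDist_compl_pos hpos) hy,
          kernel_of_mem (mem_of_infDist_compl_pos (hpos.trans_le hmono))
            (by rw [dist_add_right]; exact hy.trans_le (by gcongr)),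
          ← ENNReal.ofReal_mul (by positivity)]
        refine ENNReal.ofReal_le_ofReal ?_
        have h3 : infDist (x + t • v) Dᶜ ≤ (1 + 2 / m) * infDist x Dᶜ := by
          have : 2 * t ≤ 2 / m * infDist x Dᶜ := by
            rw [div_mul_eq_mul_div, le_div_iff₀ hm0]
            linarith
          linarith
        rw [Real.rpow_neg hpos.le, Real.rpow_neg infDist_nonneg, ← div_eq_mul_inv,
          le_div_iff₀ (Real.rpow_pos_of_pos (hpos.trans_le hmono) _),
          inv_mul_le_iff₀ (by positivity), mul_comm, hb, ← Real.mul_rpow (by positivity) hpos.le]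
        exact Real.rpow_le_rpow infDist_nonneg h3 hq0
      · simp [kernel_of_notMem (fun h' => hy h'.2)]
  -- on `A₂`, the choice of `m` makes the ball of radius `2 m t` about `x + t e` small compared to
  -- `δ` times the distance of its points to the boundary, which is at least `(κ - 2 m) t`
  have h2 : energy D δ q p A₂ (shiftAverage ρ w t) ≤ c * energy D δ q p B w := by
    refine hnear w hwm hw t ht A₂ B hA₂m (hle _) fun x hx => ?_
    obtain ⟨hxD, hx2, hx3⟩ := hx
    refine ⟨hxD, hx3, fun y hy => ?_⟩
    have hκt : κ * t ≤ t := mul_le_of_le_one_left ht.le hκ1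
    have hmt : 6 * (m * t) ≤ κ * t := by
      have := mul_le_mul_of_nonneg_right hm1 ht.le
      linarith
    have hlow := h.mul_le_infDist_compl hD' hxD ht hκ.le (by rw [hte]; linarith)
    have hd := mem_ball.1 hy
    have h3 := infDist_le_add Dᶜ (x + t • e) y
    have h4 := infDist_le_add Dᶜ y x
    have h5 := dist_triangle y (x + t • e) x
    rw [dist_self_add_left, hte] at h5
    rw [dist_comm] at h3
    have h6 : (κ - 2 * m) * t ≤ infDist y Dᶜ := by linarith
    have hypos : 0 < infDist y Dᶜ := lt_of_lt_of_le (mul_pos (by linarith) ht) h6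
    refine ⟨?_, mem_of_infDist_compl_pos hypos, ?_, by linarith⟩
    · change infDist y Dᶜ < 3 * η
      linarith
    · have h7 : δ * ((κ - 2 * m) * t) ≤ δ * infDist y Dᶜ := by gcongr
      refine le_trans ?_ h7
      have h8 : δ * m ≤ m := mul_le_of_le_one_left hm0.le hδ
      have h9 : 4 * m ≤ δ * (κ - 2 * m) := by
        have : 6 * m = δ * κ := by rw [hm]; ring
        linarith
      calc 4 * m * t ≤ δ * (κ - 2 * m) * t := by gcongr
        _ = _ := by ring
  have hsub : A ⊆ A₀ ∪ (A₁ ∪ A₂) := by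
    intro x hx
    by_cases hxD : x ∈ D
    · rcases le_or_gt (r / 2) (dist x z) with hz | hz
      · exact Or.inl ⟨hx, fun _ => hz⟩
      · rcases le_total (m * t) (infDist x Dᶜ) with hm | hm
        · exact Or.inr (Or.inl ⟨hx, hz, hm⟩)
        · exact Or.inr (Or.inr ⟨hxD, hz, hm⟩)
    · exact Or.inl ⟨hx, fun h' => absurd h' hxD⟩
  calc _ ≤ energy D δ q p A₀ (shiftAverage ρ w t) +
        energy D δ q p (A₁ ∪ A₂) (shiftAverage ρ w t) := energy_le_of_subset_union hsub
    _ ≤ 0 + (ENNReal.ofReal b * energy D δ q p B w + c * energy D δ q p B w) := by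
        rw [h0]
        gcongr
        exact (energy_le_of_subset_union le_rfl).trans (add_le_add h1 h2)
    _ = _ := by rw [zero_add, add_mul]

theorem exists_energy_layer_le (hD : IsOpen D) (hD' : Dᶜ.Nonempty) (hwm : Measurable w)
    (hw : energy D δ q p univ w < ⊤) {ε : ℝ≥0∞} (hε : ε ≠ 0) :
    ∃ η > 0, energy D δ q p {x | infDist x Dᶜ < η} w ≤ ε := by
  set H : E → ℝ≥0∞ := fun x => ∫⁻ y, kernel D δ q x y * ‖w x - w y‖ₑ ^ p with hH
  have hHm : Measurable H := measurable_energy_inner hD hwm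
  have hle (a : ℝ) : MeasurableSet {x : E | infDist x Dᶜ < a} :=
    measurableSet_lt (continuous_infDist_pt _).measurable measurable_const
  have hlim : Filter.Tendsto
      (fun n : ℕ => ∫⁻ x, {x : E | infDist x Dᶜ < 1 / ((n : ℝ) + 1)}.indicator H x)
      Filter.atTop (𝓝 (∫⁻ _ : E, 0)) := by
    refine tendsto_lintegral_of_dominated_convergence H (fun n => hHm.indicator (hle _))
      (fun n => .of_forall fun x => indicator_le_self _ _ _) ?_ (.of_forall fun x => ?_)
    · rw [energy, Measure.restrict_univ] at hw
      exact hw.ne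
    · by_cases hx : x ∈ D
      · refine tendsto_const_nhds.congr' ?_
        filter_upwards [(tendsto_one_div_add_atTop_nhds_zero_nat (𝕜 := ℝ)).eventually_lt_const
          (infDist_compl_pos hD hD' hx)] with n hn
        have hn' : x ∉ {x : E | infDist x Dᶜ < 1 / ((n : ℝ) + 1)} := fun h => lt_asymm hn h
        rw [indicator_of_notMem hn']
      · have hHx : H x = 0 := by
          simp [hH, kernel_of_notMem (fun h : x ∈ D ∧ _ => hx h.1)]
        refine tendsto_const_nhds.congr fun n => ?_
        by_cases hn : x ∈ {x : E | infDist x Dᶜ < 1 / ((n : ℝ) + 1)}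
        · rw [indicator_of_mem hn, hHx]
        · rw [indicator_of_notMem hn]
  rw [lintegral_zero] at hlim
  obtain ⟨n, hn⟩ := ((ENNReal.tendsto_nhds_zero.1 hlim) ε hε.bot_lt).exists
  refine ⟨1 / ((n : ℝ) + 1), by positivity, ?_⟩
  rwa [lintegral_indicator (hle _)] at hn

/-- A function of finite energy that is concentrated near a boundary point with a cone condition is
approximated by its averaged translations. -/
theorem ConeCondition.smoothlyApproximable (h : ConeCondition D z e r κ) (hD : IsOpen D)
    (hD' : Dᶜ.Nonempty) (hr : 0 < r) (he : ‖e‖ = 1) (hκ : 0 < κ) (hκ1 : κ ≤ 1) (hδ0 : 0 < δ)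
    (hδ : δ ≤ 1) (hp : 1 ≤ p) (hq0 : 0 ≤ q) (hq : q ≤ Module.finrank ℝ E + p)
    {R : ℝ} (hR : ∀ x, infDist x Dᶜ ≤ R) (hwm : Measurable w) (hw2 : ∫⁻ x, ‖w x‖ₑ ^ p < ⊤)
    (hwE : energy D δ q p univ w < ⊤) (hw0 : ∀ x, r / 4 ≤ dist x z → w x = 0) :
    SmoothlyApproximable D δ q p w := by
  intro ε hε
  obtain ⟨ρ, hρ⟩ := exists_isMollifier e (κ := δ * κ / 6) (by positivity)
  obtain ⟨c, hc, hcE⟩ :=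
    h.exists_energy_shiftAverage_le hD hD' he hκ hκ1 hδ0 hδ hρ hp hq0 hq
  have hw : LocallyIntegrable w :=
    (memLp_of_lintegral_lt_top hp hwm hw2).locallyIntegrable (by simpa using hp)
  have h2t : (2 : ℝ≥0∞) ^ (p - 1) ≠ ⊤ := ENNReal.rpow_ne_top_of_nonneg (by linarith) (by simp)
  have h20 : (2 : ℝ≥0∞) ^ (p - 1) ≠ 0 := (ENNReal.rpow_pos two_pos (by simp)).ne'
  have hε2 : ε / 2 ≠ 0 := by simp [hε]
  set K : ℝ≥0∞ := 2 ^ (p - 1) * (c + 1) with hK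
  have hK0 : K ≠ 0 := mul_ne_zero h20 (by simp)
  have hKt : K ≠ ⊤ := by finiteness
  obtain ⟨η₀, hη₀, hη₀E⟩ := exists_energy_layer_le hD hD' hwm hwE (ENNReal.div_pos hε2 hKt).ne'
  set η := min (η₀ / 3) (r / 16) with hη
  have hη0 : 0 < η := lt_min (by positivity) (by positivity)
  have hηE : energy D δ q p {x | infDist x Dᶜ < 3 * η} w ≤ ε / 2 / K := by
    refine (energy_mono_set fun x hx => ?_).trans hη₀E
    have h1 : infDist x Dᶜ < 3 * η := hx
    have h2 : η ≤ η₀ / 3 := min_le_left _ _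
    change infDist x Dᶜ < η₀
    linarith
  obtain ⟨c', hc', hfar⟩ :=
    exists_energy_le_lintegral (D := D) hp hδ hq0 (fun x _ => hR x) hη0
  have hev := tendsto_lintegral_shiftAverage hρ hp hwm hw hw2
    (ε := min ε (ε / 2 / (c' + 1))) (by simp [hε, hc'])
  obtain ⟨t, ht1, ht0, htη⟩ := (hev.and (Ioc_mem_nhdsGT hη0)).exists
  have hS := contDiff_shiftAverage hρ hw ht0
  refine ⟨shiftAverage ρ w t, hS, ht1.trans (min_le_left _ _), ?_⟩
  have hSm : Measurable (shiftAverage ρ w t) := hS.continuous.measurable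
  have hA : MeasurableSet {x : E | infDist x Dᶜ < η} :=
    measurableSet_lt (continuous_infDist_pt _).measurable measurable_const
  have hE1 : energy D δ q p {x | infDist x Dᶜ < η} (fun x => shiftAverage ρ w t x - w x) ≤
      ε / 2 := by
    calc _ ≤ 2 ^ (p - 1) * (energy D δ q p {x | infDist x Dᶜ < η} (shiftAverage ρ w t) +
          energy D δ q p {x | infDist x Dᶜ < η} (fun x => -w x)) := by
          simp_rw [sub_eq_add_neg]
          exact energy_add_le hD hp hSm
      _ ≤ 2 ^ (p - 1) * (c * (ε / 2 / K) + ε / 2 / K) := by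
          rw [energy_neg]
          gcongr
          · exact (hcE w hwm hw hw0 t η ht0 htη (min_le_right _ _)).trans (by gcongr)
          · refine (energy_mono_set fun x (hx : _ < η) => ?_).trans hηE
            change infDist x Dᶜ < 3 * η
            linarith
      _ = K * (ε / 2 / K) := by rw [hK]; ring
      _ = ε / 2 := ENNReal.mul_div_cancel hK0 hKt
  have hE2 : energy D δ q p {x | infDist x Dᶜ < η}ᶜ (fun x => shiftAverage ρ w t x - w x) ≤
      ε / 2 := by
    calc _ ≤ c' * (ε / 2 / (c' + 1)) := by
          refine (hfar _ hA.compl (fun x hx _ => by simpa using hx) _ (hSm.sub hwm)).trans ?_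
          gcongr
          exact ht1.trans (min_le_right _ _)
      _ ≤ (c' + 1) * (ε / 2 / (c' + 1)) := by gcongr; exact le_self_add
      _ = ε / 2 := ENNReal.mul_div_cancel (by simp) (by simp [hc'])
  calc _ ≤ ε / 2 + ε / 2 :=
        (energy_le_of_subset_union (by rw [union_compl_self])).trans (add_le_add hE1 hE2)
    _ = ε := ENNReal.add_halves ε

end Cone

/-! ### Gluing the local approximations -/

section Gluing

variable [(volume : Measure E).IsAddHaarMeasure] {D : Set E} {δ q p : ℝ} {u v w ζ : E → ℝ} {z : E}

theorem SmoothlyApproximable.zero (hp : 1 ≤ p) : SmoothlyApproximable D δ q p fun _ => 0 := by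
  intro ε _
  have h0 : (0 : ℝ≥0∞) ^ p = 0 := ENNReal.zero_rpow_of_pos (by linarith)
  exact ⟨fun _ => 0, contDiff_const, by simp [h0], by simp [energy, h0]⟩

theorem SmoothlyApproximable.add (hv : SmoothlyApproximable D δ q p v)
    (hw : SmoothlyApproximable D δ q p w) (hD : IsOpen D) (hp : 1 ≤ p) (hvm : Measurable v) :
    SmoothlyApproximable D δ q p fun x => v x + w x := by
  intro ε hε
  have h2t : (2 : ℝ≥0∞) ^ (p - 1) ≠ ⊤ := ENNReal.rpow_ne_top_of_nonneg (by linarith) (by simp)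
  have h20 : (2 : ℝ≥0∞) ^ (p - 1) ≠ 0 := (ENNReal.rpow_pos two_pos (by simp)).ne'
  set a := ε / 2 / 2 ^ (p - 1) with ha
  have ha0 : a ≠ 0 := (ENNReal.div_pos (by simp [hε]) h2t).ne'
  have hsum : 2 ^ (p - 1) * (a + a) = ε := by
    rw [mul_add, ha, ENNReal.mul_div_cancel h20 h2t, ENNReal.add_halves]
  obtain ⟨f, hf, hf1, hf2⟩ := hv a ha0
  obtain ⟨g, hg, hg1, hg2⟩ := hw a ha0
  have heq : (fun x => f x + g x - (v x + w x)) = fun x => (f x - v x) + (g x - w x) := by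
    funext x; ring
  have hm : Measurable fun x => f x - v x := hf.continuous.measurable.sub hvm
  refine ⟨fun x => f x + g x, hf.add hg, ?_, ?_⟩
  · calc _ = ∫⁻ x, ‖(f x - v x) + (g x - w x)‖ₑ ^ p := by
          refine lintegral_congr fun x => ?_
          rw [show f x + g x - (v x + w x) = (f x - v x) + (g x - w x) by ring]
      _ ≤ 2 ^ (p - 1) * (a + a) := (rpow_enorm_add_lintegral_le hp hm).trans (by gcongr)
      _ = ε := hsum
  · rw [heq, ← hsum]
    exact (energy_add_le hD hp hm).trans (by gcongr)

theorem SmoothlyApproximable.sum {ι : Type*} (s : Finset ι) {f : ι → E → ℝ}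
    (hf : ∀ i ∈ s, SmoothlyApproximable D δ q p (f i)) (hD : IsOpen D) (hp : 1 ≤ p)
    (hfm : ∀ i, Measurable (f i)) :
    SmoothlyApproximable D δ q p fun x => ∑ i ∈ s, f i x := by
  classical
  induction s using Finset.induction_on with
  | empty => simpa using SmoothlyApproximable.zero hp
  | insert i s hi ih =>
    simp only [Finset.sum_insert hi]
    exact (hf i (Finset.mem_insert_self i s)).add
      (ih fun j hj => hf j (Finset.mem_insert_of_mem hj)) hD hp (hfm i)

/-- Cutting off inside `D`: there the energy is controlled by the `L^p` norm. -/
theorem smoothlyApproximable_mul_interior (hp : 1 ≤ p) (hδ : δ ≤ 1) (hq0 : 0 ≤ q)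
    {R : ℝ} (hR : ∀ x, infDist x Dᶜ ≤ R) (hu : Measurable u) (hu2 : ∫⁻ x, ‖u x‖ₑ ^ p < ⊤)
    (hζ : ContDiff ℝ ∞ ζ) (hζ1 : ∀ x, ‖ζ x‖ₑ ≤ 1) {m : ℝ} (hm : 0 < m)
    (hζ0 : ∀ x, infDist x Dᶜ ≤ m → ζ x = 0) :
    SmoothlyApproximable D δ q p fun x => ζ x * u x := by
  intro ε hε
  obtain ⟨c, hc, hcE⟩ := exists_energy_le_of_eq_zero (D := D) (q := q) hp hδ hq0
    (fun x _ => hR x) hm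
  obtain ⟨g, hg, hgu⟩ := exists_contDiff_lintegral_le hp hu hu2
    (ε := ε / (c + 1)) (ENNReal.div_pos hε (by simp [hc])).ne'
  have hle : ∫⁻ x, ‖ζ x * g x - ζ x * u x‖ₑ ^ p ≤ ε / (c + 1) := by
    refine (lintegral_mono fun x => ?_).trans hgu
    refine ENNReal.rpow_le_rpow ?_ (by linarith)
    rw [← mul_sub, enorm_mul]
    exact mul_le_of_le_one_left' (hζ1 x)
  refine ⟨fun x => ζ x * g x, hζ.mul hg, hle.trans ?_, ?_⟩
  · exact ENNReal.div_le_of_le_mul (le_mul_of_one_le_right' le_add_self)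
  · refine (hcE (fun x => ζ x * g x - ζ x * u x) ((hζ.mul hg).continuous.measurable.sub
      (hζ.continuous.measurable.mul hu)) fun x _ hx => by rw [hζ0 x hx]; ring).trans ?_
    calc c * _ ≤ (c + 1) * (ε / (c + 1)) := by gcongr; exact le_self_add
      _ = ε := ENNReal.mul_div_cancel (by simp) (by simp [hc])

/-- If every boundary point admits an interior cone, then a partition of unity on the closure of
`D` reduces the approximation of `u` to its pieces supported near a single point. -/
theorem smoothlyApproximable_of_cone (hD : IsOpen D) (hD' : Dᶜ.Nonempty)
    (hDb : Bornology.IsBounded D) (hδ0 : 0 < δ) (hδ : δ ≤ 1) (hp : 1 ≤ p) (hq0 : 0 ≤ q)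
    (hq : q ≤ Module.finrank ℝ E + p) {R : ℝ} (hR : ∀ x, infDist x Dᶜ ≤ R)
    (hcone : ∀ z ∈ frontier D, ∃ (e : E) (r κ : ℝ), ‖e‖ = 1 ∧ 0 < r ∧ 0 < κ ∧ κ ≤ 1 ∧
      ConeCondition D z e r κ)
    (hu : Measurable u) (hu0 : ∀ x ∉ D, u x = 0) (hu2 : ∫⁻ x, ‖u x‖ₑ ^ p < ⊤)
    (huE : energy D δ q p univ u < ⊤) : SmoothlyApproximable D δ q p u := by
  have hloc : ∀ z ∈ closure D, ∃ a : ℝ, 0 < a ∧ ∀ ζ : E → ℝ, ContDiff ℝ ∞ ζ →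
      (∀ x, ‖ζ x‖ₑ ≤ 1) → (∀ x, a ≤ dist x z → ζ x = 0) →
      SmoothlyApproximable D δ q p fun x => ζ x * u x := by
    intro z hz
    by_cases hzD : z ∈ D
    · have hpos := infDist_compl_pos hD hD' hzD
      refine ⟨infDist z Dᶜ / 2, half_pos hpos, fun ζ hζ hζ1 hζ0 => ?_⟩
      refine smoothlyApproximable_mul_interior hp hδ hq0 hR hu hu2 hζ hζ1 (half_pos hpos)
        fun x hx => hζ0 x ?_
      have := infDist_le_add Dᶜ z x
      rw [dist_comm] at this
      linarith
    · obtain ⟨e, r, κ, he, hr, hκ, hκ1, hc⟩ := hcone z (by rw [hD.frontier_eq]; exact ⟨hz, hzD⟩)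
      refine ⟨r / 4, by positivity, fun ζ hζ hζ1 hζ0 => ?_⟩
      have hζc : HasCompactSupport ζ := HasCompactSupport.intro (isCompact_closedBall z (r / 4))
        fun x hx => hζ0 x (not_le.1 hx).le
      obtain ⟨L, hL⟩ := hζ.lipschitzWith_of_hasCompactSupport hζc (by simp)
      refine hc.smoothlyApproximable hD hD' hr he hκ hκ1 hδ0 hδ hp hq0 hq hR
        (hζ.continuous.measurable.mul hu) ?_
        (energy_mul_lt_top hD hD' hp hδ hq (fun x _ => hR x) hL hζ1 hu huE hu2)
        fun x hx => by simp [hζ0 x hx]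
      refine (lintegral_mono fun x => ENNReal.rpow_le_rpow ?_ (by linarith)).trans_lt hu2
      rw [enorm_mul]
      exact mul_le_of_le_one_left' (hζ1 x)
  choose! a ha hloc using hloc
  obtain ⟨t, htD, ht⟩ := hDb.isCompact_closure.elim_nhds_subcover (fun z => ball z (a z))
    fun z hz => ball_mem_nhds z (ha z hz)
  obtain ⟨f, hf⟩ := SmoothPartitionOfUnity.exists_isSubordinate (modelWithCornersSelf ℝ E)
    isClosed_closure (fun i : t => ball (i : E) (a i)) (fun _ => isOpen_ball)
    (by simpa [iUnion_subtype] using ht)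
  have hsum : u = fun x => ∑ i, f i x * u x := by
    funext x
    rw [← Finset.sum_mul]
    by_cases hx : x ∈ D
    · have := f.sum_eq_one (subset_closure hx)
      rw [finsum_eq_sum_of_fintype] at this
      rw [this, one_mul]
    · rw [hu0 x hx, mul_zero]
  have hfs (i : t) : ContDiff ℝ ∞ (f i) := (f i).contMDiff.contDiff
  rw [hsum]
  refine SmoothlyApproximable.sum _ (fun i _ => ?_) hD hp
    fun i => (hfs i).continuous.measurable.mul hu
  refine hloc i (htD i i.2) (f i) (hfs i) (fun x => ?_) fun x hx => ?_
  · rw [Real.enorm_of_nonneg (f.nonneg i x), ENNReal.ofReal_le_one]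
    exact f.le_one i x
  · by_contra h
    exact (not_lt.2 hx) (mem_ball.1 (hf i (subset_tsupport _ h)))

end Gluing

/-! ### The nonlocal space -/

theorem exists_coneCondition_of_lipschitz {F : Type*} [NormedAddCommGroup F]
    [InnerProductSpace ℝ F] {D : Set F} {z e : F} {r : ℝ} {K : NNReal} {g : F → ℝ}
    (he : ‖e‖ = 1) (hg : LipschitzWith K g)
    (h : ∀ x ∈ ball z r, x ∈ D ↔ g (x - inner ℝ e x • e) < inner ℝ e x) :
    ConeCondition D z e r (1 / (1 + K)) := by
  intro x hxD hxz t ht v hv hxv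
  rw [h _ hxv]
  rw [h x hxz] at hxD
  obtain ⟨a, rfl⟩ : ∃ a, v = e + a := ⟨v - e, by abel⟩
  have hK : (0 : ℝ) < 1 + K := by positivity
  have ha : ‖a‖ * (1 + K) < 1 := by
    rw [mem_ball_iff_norm, add_sub_cancel_left] at hv
    rwa [← lt_div_iff₀ hK]
  have hee : inner ℝ e e = (1 : ℝ) := by rw [real_inner_self_eq_norm_sq, he, one_pow]
  have hea : |inner ℝ e a| ≤ ‖a‖ := by simpa [he] using abs_real_inner_le_norm e a
  have hproj : ‖a - inner ℝ e a • e‖ ≤ ‖a‖ := by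
    refine le_of_sq_le_sq ?_ (norm_nonneg _)
    rw [norm_sub_sq_real, real_inner_smul_right, norm_smul, he, real_inner_comm, mul_one,
      Real.norm_eq_abs, sq_abs]
    nlinarith [sq_nonneg (inner ℝ e a)]
  have hinner : inner ℝ e (x + t • (e + a)) = inner ℝ e x + t * (1 + inner ℝ e a) := by
    rw [inner_add_right, real_inner_smul_right, inner_add_right, hee]
  have hdist := hg.dist_le_mul (x + t • (e + a) - inner ℝ e (x + t • (e + a)) • e)
    (x - inner ℝ e x • e)
  have hdiff : x + t • (e + a) - inner ℝ e (x + t • (e + a)) • e - (x - inner ℝ e x • e) =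
      t • (a - inner ℝ e a • e) := by
    rw [hinner]
    module
  rw [dist_eq_norm, dist_eq_norm, hdiff, norm_smul, Real.norm_of_nonneg ht.le,
    Real.norm_eq_abs] at hdist
  have h1 := (le_abs_self _).trans hdist
  have h2 : (K : ℝ) * (t * ‖a - inner ℝ e a • e‖) ≤ t * (K * ‖a‖) := by
    rw [mul_left_comm]
    gcongr
  have h3 : t * (K * ‖a‖) ≤ t * (1 + inner ℝ e a) := by
    gcongr
    have := (abs_le.1 hea).1
    linarith
  rw [hinner] at h1 ⊢
  linarith

theorem sigma_eq_infDist_compl {d : ℕ} {D : Set (EuclideanSpace ℝ (Fin d))} (hD : IsOpen D)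
    (hD' : D ≠ univ) {x : EuclideanSpace ℝ (Fin d)} (hx : x ∈ D) :
    sigma D x = infDist x Dᶜ := by
  obtain ⟨y, hy, hxy⟩ := exists_mem_frontier_infDist_compl_eq_dist hx hD'
  refine le_antisymm (hxy ▸ infDist_le_dist_of_mem hy) ?_
  refine infDist_le_infDist_of_subset (fun z hz => ?_) ⟨y, hy⟩
  rw [hD.frontier_eq] at hz
  exact hz.2

/-- The power of the seminorm is a constant multiple of the energy. -/
theorem seminormPow_eq_energy {d : ℕ} {D : Set (EuclideanSpace ℝ (Fin d))} (hD : IsOpen D)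
    (hD' : D ≠ univ) {s p δ : ℝ} (hp : 1 ≤ p) (hδ0 : 0 < δ)
    (u : EuclideanSpace ℝ (Fin d) → ℝ) :
    seminormPow D s p δ u = ENNReal.ofReal (normConst d p) *
      (ENNReal.ofReal (δ ^ ((d : ℝ) + p))⁻¹ * energy D δ ((d : ℝ) + s * p) p univ u) := by
  rw [seminormPow, energy, Measure.restrict_univ]
  congr 1
  rw [← lintegral_const_mul' _ _ ENNReal.ofReal_ne_top, ← lintegral_indicator hD.measurableSet]
  refine lintegral_congr fun x => ?_
  rw [← lintegral_const_mul' _ _ ENNReal.ofReal_ne_top]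
  by_cases hx : x ∈ D
  · rw [indicator_of_mem hx, ← lintegral_indicator measurableSet_ball,
      sigma_eq_infDist_compl hD hD' hx]
    refine lintegral_congr fun y => ?_
    have hpos := infDist_compl_pos hD (nonempty_compl.2 hD') hx
    by_cases hy : dist y x < δ * infDist x Dᶜ
    · rw [indicator_of_mem (mem_ball.2 hy), kernel_of_mem hx hy, Real.enorm_eq_ofReal_abs,
        ENNReal.ofReal_rpow_of_nonneg (abs_nonneg _) (by linarith),
        ← ENNReal.ofReal_mul (by positivity), ← ENNReal.ofReal_mul (by positivity),
        Real.rpow_neg hpos.le]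
      congr 1
      field_simp
    · rw [indicator_of_notMem (fun h => hy (mem_ball.1 h)),
        kernel_of_notMem (fun h => hy h.2), zero_mul, mul_zero]
  · rw [indicator_of_notMem hx]
    simp [kernel_of_notMem (fun h : x ∈ D ∧ _ => hx h.1)]

theorem normConst_pos (d : ℕ) {p : ℝ} (hp : 0 < p) : 0 < normConst d p := by
  have h1 : 0 < Real.Gamma ((p + 1) / 2) := Real.Gamma_pos_of_pos (by positivity)
  have h2 : 0 < Real.Gamma (((d : ℝ) + p) / 2) := Real.Gamma_pos_of_pos (by positivity)
  have := Real.pi_pos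
  unfold normConst sphereConst
  positivity

theorem energy_lt_top_of_memNonlocal {d : ℕ} {D : Set (EuclideanSpace ℝ (Fin d))} (hD : IsOpen D)
    (hD' : D ≠ univ) {s p δ : ℝ} (hp : 1 ≤ p) (hδ0 : 0 < δ)
    {u : EuclideanSpace ℝ (Fin d) → ℝ} (hu : MemNonlocal D s p δ u) :
    energy D δ ((d : ℝ) + s * p) p univ u < ⊤ := by
  have h := hu.2
  rw [seminormPow_eq_energy hD hD' hp hδ0] at h
  have h1 : ENNReal.ofReal (normConst d p) ≠ 0 := by
    simpa using normConst_pos d (by linarith : 0 < p)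
  have h2 : ENNReal.ofReal (δ ^ ((d : ℝ) + p))⁻¹ ≠ 0 := by
    have : 0 < δ ^ ((d : ℝ) + p) := by positivity
    simpa using this
  exact ENNReal.lt_top_of_mul_ne_top_right (ENNReal.lt_top_of_mul_ne_top_right h.ne h1).ne h2

/-- Approximation of a measurable representative up to arbitrary accuracy yields a sequence
converging in the norm of the nonlocal space. -/
theorem exists_seq_tendsto_nonlocalNorm {d : ℕ} {D : Set (EuclideanSpace ℝ (Fin d))}
    (hD : IsOpen D) (hD' : D ≠ univ) {s p δ : ℝ} (hp : 1 ≤ p) (hδ0 : 0 < δ) (hδ : δ ≤ 1)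
    {u u' : EuclideanSpace ℝ (Fin d) → ℝ} (hu : MemNonlocal D s p δ u) (hu' : Measurable u')
    (huu' : u =ᵐ[volume.restrict D] u') {Q : (EuclideanSpace ℝ (Fin d) → ℝ) → Prop}
    (hQ : ∀ v, Q v → AEStronglyMeasurable v (volume.restrict D))
    (h : ∀ ε : ℝ≥0∞, ε ≠ 0 → ∃ v, Q v ∧ ∫⁻ x, ‖v x - u' x‖ₑ ^ p ≤ ε ∧
      energy D δ ((d : ℝ) + s * p) p univ (fun x => v x - u' x) ≤ ε) :
    ∃ v : ℕ → EuclideanSpace ℝ (Fin d) → ℝ, (∀ n, Q (v n) ∧ MemNonlocal D s p δ (v n)) ∧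
      Filter.Tendsto (fun n => nonlocalNorm D s p δ (v n - u)) Filter.atTop (𝓝 0) := by
  have hp0 : 0 < p := by linarith
  have h2t : (2 : ℝ≥0∞) ^ (p - 1) ≠ ⊤ := ENNReal.rpow_ne_top_of_nonneg (by linarith) (by simp)
  choose v hQv hv1 hv2 using fun n : ℕ => h ((n : ℝ≥0∞) + 1)⁻¹ (by simp)
  have hεt (n : ℕ) : ((n : ℝ≥0∞) + 1)⁻¹ ≠ ⊤ := by simp
  set C : ℝ≥0∞ := ENNReal.ofReal (normConst d p) * ENNReal.ofReal (δ ^ ((d : ℝ) + p))⁻¹ with hC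
  have hCt : C ≠ ⊤ := by finiteness
  have hsemi (w : EuclideanSpace ℝ (Fin d) → ℝ) :
      seminormPow D s p δ w = C * energy D δ ((d : ℝ) + s * p) p univ w := by
    rw [seminormPow_eq_energy hD hD' hp hδ0, hC, mul_assoc]
  have hsub (n : ℕ) : (v n - u) =ᵐ[volume.restrict D] fun x => v n x - u' x :=
    huu'.mono fun x hx => by simp [hx]
  have hL (n : ℕ) : eLpNorm (v n - u) (ENNReal.ofReal p) (volume.restrict D) ^ p ≤
      ((n : ℝ≥0∞) + 1)⁻¹ := by
    rw [eLpNorm_congr_ae (hsub n), eLpNorm_rpow_eq hp]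
    exact (setLIntegral_le_lintegral _ _).trans (hv1 n)
  have hS (n : ℕ) : seminormPow D s p δ (v n - u) ≤ C * ((n : ℝ≥0∞) + 1)⁻¹ := by
    rw [hsemi, energy_congr_ae hD hδ (hsub n)]
    gcongr
    exact hv2 n
  have hb : Filter.Tendsto (fun n : ℕ => ((n : ℝ≥0∞) + 1)⁻¹) Filter.atTop (𝓝 0) := by
    have := (Filter.tendsto_add_atTop_iff_nat (f := fun n : ℕ => ((n : ℝ≥0∞))⁻¹) 1).2
      ENNReal.tendsto_inv_nat_nhds_zero
    simpa using this
  refine ⟨v, fun n => ⟨hQv n, ?_, ?_⟩, ?_⟩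
  · have hd : MemLp (v n - u) (ENNReal.ofReal p) (volume.restrict D) := by
      refine ⟨(hQ _ (hQv n)).sub hu.1.1, ?_⟩
      have h1 := (hL n).trans_lt (hεt n).lt_top
      exact (ENNReal.rpow_lt_top_iff_of_pos hp0).1 h1
    simpa using hd.add hu.1
  · have hu2 : energy D δ ((d : ℝ) + s * p) p univ u' ≠ ⊤ := by
      rw [← energy_congr_ae hD hδ huu']
      exact (energy_lt_top_of_memNonlocal hD hD' hp hδ0 hu).ne
    rw [hsemi]
    refine ENNReal.mul_lt_top hCt.lt_top ?_
    have heq : v n = fun x => u' x + (v n x - u' x) := by funext x; ring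
    rw [heq]
    refine (energy_add_le hD hp hu').trans_lt ?_
    have := ne_top_of_le_ne_top (hεt n) (hv2 n)
    finiteness
  · have hlim : Filter.Tendsto
        (fun n : ℕ => (((n : ℝ≥0∞) + 1)⁻¹ + C * ((n : ℝ≥0∞) + 1)⁻¹) ^ (1 / p))
        Filter.atTop (𝓝 0) := by
      have h1 := (hb.add (ENNReal.Tendsto.const_mul hb (Or.inr hCt))).ennrpow_const (1 / p)
      simpa [ENNReal.zero_rpow_of_pos (inv_pos.2 hp0)] using h1
    refine tendsto_of_tendsto_of_tendsto_of_le_of_le tendsto_const_nhds hlim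
      (fun n => zero_le) fun n => ?_
    exact ENNReal.rpow_le_rpow (add_le_add (hL n) (hS n)) (by positivity)

end NonlocalSpace

end

theorem mainTheorem6 (d : ℕ) (hd : 0 < d) (p s δ : ℝ) (hp : 1 < p)
    (hs : s ∈ Set.Ioc (0 : ℝ) 1) (hδ : δ ∈ Set.Ioo (0 : ℝ) 1)
    (D : Set (EuclideanSpace ℝ (Fin d))) (hD : IsOpen D) (hDb : Bornology.IsBounded D)
    (u : EuclideanSpace ℝ (Fin d) → ℝ) (hu : NonlocalSpace.MemNonlocal D s p δ u) :
    (∃ v : ℕ → EuclideanSpace ℝ (Fin d) → ℝ,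
      (∀ n, ContDiffOn ℝ ∞ (v n) D ∧ NonlocalSpace.MemNonlocal D s p δ (v n)) ∧
      Filter.Tendsto (fun n => NonlocalSpace.nonlocalNorm D s p δ (v n - u))
        Filter.atTop (𝓝 0)) ∧
    (NonlocalSpace.HasLipschitzBoundary D →
      ∃ v : ℕ → EuclideanSpace ℝ (Fin d) → ℝ,
        (∀ n, NonlocalSpace.SmoothUpToBoundary D (v n) ∧
          NonlocalSpace.MemNonlocal D s p δ (v n)) ∧
        Filter.Tendsto (fun n => NonlocalSpace.nonlocalNorm D s p δ (v n - u))
          Filter.atTop (𝓝 0)) := by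
  have : Nonempty (Fin d) := ⟨⟨0, hd⟩⟩
  have hp1 : 1 ≤ p := hp.le
  have hD' : D ≠ univ := by
    rintro rfl
    exact NormedSpace.unbounded_univ ℝ (EuclideanSpace ℝ (Fin d)) hDb
  have hDc : Dᶜ.Nonempty := nonempty_compl.2 hD'
  have hsp : 0 < s * p := mul_pos hs.1 (by linarith)
  have hq0 : 0 ≤ (d : ℝ) + s * p := by positivity
  have hq : (d : ℝ) + s * p ≤ Module.finrank ℝ (EuclideanSpace ℝ (Fin d)) + p := by
    rw [finrank_euclideanSpace_fin]
    have := mul_le_of_le_one_left (by linarith : 0 ≤ p) hs.2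
    linarith
  obtain ⟨R, hR0, hR⟩ : ∃ R : ℝ, 0 < R ∧ ∀ x, infDist x Dᶜ ≤ R := by
    obtain ⟨a, ha⟩ := hDc
    obtain ⟨R, hR⟩ := hDb.subset_closedBall a
    refine ⟨max R 1, by positivity, fun x => ?_⟩
    by_cases hx : x ∈ D
    · exact (infDist_le_dist_of_mem ha).trans ((mem_closedBall.1 (hR hx)).trans (le_max_left _ _))
    · rw [infDist_zero_of_mem hx]
      positivity
  -- a Borel representative of `u` that vanishes off `D`
  obtain ⟨u₀, hu₀, huu₀⟩ := hu.1.1.aemeasurable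
  set u' : EuclideanSpace ℝ (Fin d) → ℝ := D.indicator u₀ with hu'_def
  have hu' : Measurable u' := hu₀.indicator hD.measurableSet
  have huu' : u =ᵐ[volume.restrict D] u' :=
    huu₀.trans (indicator_ae_eq_restrict hD.measurableSet).symm
  have hu'0 : ∀ x ∉ D, u' x = 0 := fun x hx => indicator_of_notMem hx _
  have hu'2 : ∫⁻ x, ‖u' x‖ₑ ^ p < ⊤ := by
    have h1 : ∫⁻ x, ‖u' x‖ₑ ^ p = ∫⁻ x in D, ‖u' x‖ₑ ^ p := by
      rw [← lintegral_indicator hD.measurableSet]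
      refine lintegral_congr fun x => ?_
      by_cases hx : x ∈ D
      · rw [indicator_of_mem hx]
      · rw [indicator_of_notMem hx, hu'0 x hx, enorm_zero, ENNReal.zero_rpow_of_pos (by linarith)]
    rw [h1, ← NonlocalSpace.eLpNorm_rpow_eq hp1, ← eLpNorm_congr_ae huu']
    exact ENNReal.rpow_lt_top_of_nonneg (by linarith) hu.1.2.ne
  have hu'E : NonlocalSpace.energy D δ ((d : ℝ) + s * p) p univ u' < ⊤ := by
    rw [← NonlocalSpace.energy_congr_ae hD hδ.2.le huu']
    exact NonlocalSpace.energy_lt_top_of_memNonlocal hD hD' hp1 hδ.1 hu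
  refine ⟨?_, fun hLip => ?_⟩
  · refine NonlocalSpace.exists_seq_tendsto_nonlocalNorm hD hD' hp1 hδ.1 hδ.2.le hu hu' huu'
      (Q := fun v => ContDiffOn ℝ ∞ v D)
      (fun v hv => hv.continuousOn.aestronglyMeasurable hD.measurableSet) fun ε hε => ?_
    exact NonlocalSpace.exists_contDiffOn_approx hD hDc hp1 hδ.2.le hq0 hR0 hR hu' hu'2 hε
  · refine NonlocalSpace.exists_seq_tendsto_nonlocalNorm hD hD' hp1 hδ.1 hδ.2.le hu hu' huu'
      (fun v hv => ?_) fun ε hε => ?_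
    · obtain ⟨V, hV, hvV⟩ := hv
      exact (hV.continuous.continuousOn.congr hvV).aestronglyMeasurable hD.measurableSet
    · obtain ⟨V, hV, hV1, hV2⟩ := NonlocalSpace.smoothlyApproximable_of_cone hD hDc hDb hδ.1 hδ.2.le
        hp1 hq0 hq hR (fun z hz => by
          obtain ⟨e, r, K, g, he, hr, hg, h⟩ := hLip z hz
          have hK : (0 : ℝ) < 1 + K := by positivity
          exact ⟨e, r, 1 / (1 + K), he, hr, by positivity,
            (div_le_one hK).2 (le_add_of_nonneg_right K.coe_nonneg),
            NonlocalSpace.exists_coneCondition_of_lipschitz he hg h⟩)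
        hu' hu'0 hu'2 hu'E ε hε
      exact ⟨V, ⟨V, hV, fun _ _ => rfl⟩, hV1, hV2⟩
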